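/- Let $A$ be a separable unital $C^*$-algebra. An odd spectral triple $(\mathcal A,\mathsf H,D)$ on $A$ consists of a (unital) representation $\pi$ of $A$ on a Hilbert space $\mathsf H$, a dense $^*$-subalgebra $\mathcal A\subset A$ and a densely defined self-adjoint operator $D$ on $\mathsf H$ such that $(1+D^2)^{-1/2}$ is compact and, for every $a\in\mathcal A$, $\pi(a)$ maps the domain of $D$ into itself and $[D,\pi(a)]$ extends to a bounded operator. It is even if, in addition, there is a Hilbert space decomposition $\mathsf H=\mathsf H_0\oplus\mathsf H_1$ with respect to which $\pi=\pi_0\oplus\pi_1$ and $D=\begin{bmatrix}0&D_0\\D_0^*&0\end{bmatrix}$. For $p>0$, $D$ is $p$-summable if $(1+D^2)^{-p/2}$ is a trace class operator. The triple is non-degenerate if $\pi$ is faithful and, for $a\in\mathcal A$, $[D,\pi(a)]=0$ if and only if $a\in\mathbb C1$. A function $l:\Gamma\to\mathbb Z$ on a discrete group $\Gamma$ is proper translation bounded if $l(g)=0$ exactly when $g$ is the identity, every level set $\{g\in\Gamma: l(g)=n\}$ is finite, and for each $g\in\Gamma$ the function $x\mapsto l(x)-l(g^{-1}x)$ is bounded;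 $M_l$ denotes the self-adjoint operator of multiplication by $l$ on $\ell^2(\Gamma)$. Let $(\mathcal A,\mathsf H_A,D_A)$ be an odd spectral triple on a separable unital $C^*$-algebra $A$ with faithful representation $\pi$, let $\Gamma$ be a discrete group with a proper translation bounded function $l:\Gamma\to\mathbb Z$, and let $\alpha:\Gamma\to\mathrm{Aut}(A)$ be an action such that $\alpha_g(\mathcal A)\subset\mathcal A$ for all $g\in\Gamma$ and $$\sup_{g\in\Gamma}\|[D_A,\pi(\alpha_g(a))]\|<\infty\qquad\text{for every }a\in\mathcal A.$$ Put $\mathsf H=\mathsf H_A\otimes\ell^2(\Gamma)$, and let $A\rtimes_{r,\alpha}\Gamma\subset\mathbb B(\mathsf H)$ be the reduced crossed product, that is, the $C^*$-algebra generated by the operators $\tilde\pi(a)$, $a\in A$, and $\lambda_h$, $h\in\Gamma$, where $$\tilde\pi(a)(\xi\otimes\delta_g)=\pi(\alpha_{g^{-1}}(a))\xi\otimes\delta_g,\qquad \lambda_h(\xi\otimes\delta_g)=\xi\otimes\delta_{hg}.$$ Let $C_c(\Gamma,\mathcal A)$ be the $^*$-subalgebra of the finite sums $\sum_g\tilde\pi(x_g)\lambda_g$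 with $x_g\in\mathcal A$, let $A\rtimes_{r,\alpha}\Gamma$ act on $\mathsf H\oplus\mathsf H$ by $x\mapsto x\oplus x$, and let $$D=\begin{bmatrix}0&D_A\otimes1-i\otimes M_l\\D_A\otimes1+i\otimes M_l&0\end{bmatrix}$$ on $\mathsf H\oplus\mathsf H$. Then: (i) $(C_c(\Gamma,\mathcal A),\mathsf H\oplus\mathsf H,D)$ is an even spectral triple on $A\rtimes_{r,\alpha}\Gamma$, with respect to the given decomposition of $\mathsf H\oplus\mathsf H$; (ii) for all $p,q>0$, if $D_A$ is $p$-summable and $M_l$ is $q$-summable, then $D$ is $(p+q)$-summable; (iii) if $(\mathcal A,\mathsf H_A,D_A)$ is non-degenerate, then so is $(C_c(\Gamma,\mathcal A),\mathsf H\oplus\mathsf H,D)$. -/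

import Mathlib

open scoped ENNReal InnerProductSpace LinearPMap

noncomputable section

namespace CrossedTriple

universe u v w

/-! ### Unbounded operators on Hilbert spaces -/

section Operators

variable {H : Type u} [NormedAddCommGroup H] [InnerProductSpace ℂ H]

/-- `T` is the bounded extension of the commutator `[D, S]`: the bounded operator `S` maps the
domain of `D` into itself and `D S x - S D x = T x` for every `x` in the domain of `D`. -/
def IsCommutator (D : H →ₗ.[ℂ] H) (S T : H →L[ℂ] H) : Prop :=
  ∀ x : D.domain, ∃ h : S x ∈ D.domain, D ⟨S x, h⟩ - S (D x) = T x

/-- `R = (1 + D²)⁻¹`: the bounded operator `R` is the inverse of the operator `1 + D²`, whose domain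
is the set of `y` in the domain of `D` such that `D y` is again in the domain of `D`. -/
def IsInvOneAddSq (D : H →ₗ.[ℂ] H) (R : H →L[ℂ] H) : Prop :=
  ∀ x y : H, R x = y ↔
    ∃ (hy : y ∈ D.domain) (hDy : D ⟨y, hy⟩ ∈ D.domain), y + D ⟨D ⟨y, hy⟩, hDy⟩ = x

variable [CompleteSpace H]

/-- `(1 + D²)^{-1/2}` is a compact operator. -/
def HasCompactResolvent (D : H →ₗ.[ℂ] H) : Prop :=
  ∃ R : H →L[ℂ] H, IsInvOneAddSq D R ∧ IsCompactOperator (R ^ (1 / 2 : ℝ))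

/-- `T` is a trace class operator: the trace of `|T|` is finite in every Hilbert basis. -/
def IsTraceClass (T : H →L[ℂ] H) : Prop :=
  ∀ (ι : Type u) (e : HilbertBasis ι ℂ H),
    Summable fun i => (⟪e i, CFC.abs T (e i)⟫_ℂ).re

/-- `D` is `p`-summable: `(1 + D²)^{-p/2}` is a trace class operator. -/
def IsPSummable (D : H →ₗ.[ℂ] H) (p : ℝ) : Prop :=
  ∃ R : H →L[ℂ] H, IsInvOneAddSq D R ∧ IsTraceClass (R ^ (p / 2))

end Operators

/-! ### Orthogonal direct sums of two Hilbert spaces -/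

section DirectSum

variable {H₀ : Type u} [NormedAddCommGroup H₀] [InnerProductSpace ℂ H₀]
  {H₁ : Type v} [NormedAddCommGroup H₁] [InnerProductSpace ℂ H₁]

/-- The operator `[[0, S], [T, 0]]` on `H₀ ⊕ H₁`, with domain `dom T ⊕ dom S`. -/
def offDiag (S : H₁ →ₗ.[ℂ] H₀) (T : H₀ →ₗ.[ℂ] H₁) :
    WithLp 2 (H₀ × H₁) →ₗ.[ℂ] WithLp 2 (H₀ × H₁) where
  domain :=
    { carrier := {x | x.fst ∈ T.domain ∧ x.snd ∈ S.domain}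
      add_mem' := fun hx hy => ⟨add_mem hx.1 hy.1, add_mem hx.2 hy.2⟩
      zero_mem' := ⟨zero_mem _, zero_mem _⟩
      smul_mem' := fun c _ hx => ⟨Submodule.smul_mem _ c hx.1, Submodule.smul_mem _ c hx.2⟩ }
  toFun :=
    { toFun := fun x =>
        WithLp.toLp 2 (S ⟨(x : WithLp 2 (H₀ × H₁)).snd, x.2.2⟩,
          T ⟨(x : WithLp 2 (H₀ × H₁)).fst, x.2.1⟩)
      map_add' := fun x y => by
        have h₁ := S.map_add ⟨(x : WithLp 2 (H₀ × H₁)).snd, x.2.2⟩ ⟨(y : WithLp 2 (H₀ × H₁)).snd, y.2.2⟩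
        have h₂ := T.map_add ⟨(x : WithLp 2 (H₀ × H₁)).fst, x.2.1⟩ ⟨(y : WithLp 2 (H₀ × H₁)).fst, y.2.1⟩
        apply (WithLp.ofLp_injective 2)
        exact Prod.ext h₁ h₂
      map_smul' := fun c x => by
        have h₁ := S.map_smul c ⟨(x : WithLp 2 (H₀ × H₁)).snd, x.2.2⟩
        have h₂ := T.map_smul c ⟨(x : WithLp 2 (H₀ × H₁)).fst, x.2.1⟩
        apply (WithLp.ofLp_injective 2)
        exact Prod.ext h₁ h₂ }

/-- The bounded operator `S ⊕ T` on `H₀ ⊕ H₁`. -/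
def diagOp (S : H₀ →L[ℂ] H₀) (T : H₁ →L[ℂ] H₁) : WithLp 2 (H₀ × H₁) →L[ℂ] WithLp 2 (H₀ × H₁) :=
  (WithLp.prodContinuousLinearEquiv 2 ℂ H₀ H₁).symm.toContinuousLinearMap ∘L
    (S.prodMap T) ∘L (WithLp.prodContinuousLinearEquiv 2 ℂ H₀ H₁).toContinuousLinearMap

theorem diagOp_apply (S : H₀ →L[ℂ] H₀) (T : H₁ →L[ℂ] H₁) (x : WithLp 2 (H₀ × H₁)) :
    diagOp S T x = WithLp.toLp 2 (S x.fst, T x.snd) := rfl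

variable [CompleteSpace H₀] [CompleteSpace H₁]

/-- The direct sum `π₀ ⊕ π₁` of two representations. -/
def diagRep {B : Type w} [CStarAlgebra B] (π₀ : B →⋆ₐ[ℂ] (H₀ →L[ℂ] H₀))
    (π₁ : B →⋆ₐ[ℂ] (H₁ →L[ℂ] H₁)) :
    B →⋆ₐ[ℂ] (WithLp 2 (H₀ × H₁) →L[ℂ] WithLp 2 (H₀ × H₁)) where
  toFun b := diagOp (π₀ b) (π₁ b)
  map_one' := ContinuousLinearMap.ext fun x => WithLp.ofLp_injective 2 <|
    Prod.ext (by simp [diagOp_apply]) (by simp [diagOp_apply])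
  map_mul' a b := ContinuousLinearMap.ext fun x => WithLp.ofLp_injective 2 <|
    Prod.ext (by simp [diagOp_apply]) (by simp [diagOp_apply])
  map_zero' := ContinuousLinearMap.ext fun x => WithLp.ofLp_injective 2 <|
    Prod.ext (by simp [diagOp_apply]) (by simp [diagOp_apply])
  map_add' a b := ContinuousLinearMap.ext fun x => WithLp.ofLp_injective 2 <|
    Prod.ext (by simp [diagOp_apply]) (by simp [diagOp_apply])
  commutes' c := ContinuousLinearMap.ext fun x => WithLp.ofLp_injective 2 <|
    Prod.ext (by simp [diagOp_apply, Algebra.algebraMap_eq_smul_one]) (by simp [diagOp_apply, Algebra.algebraMap_eq_smul_one])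
  map_star' a := by
    rw [ContinuousLinearMap.star_eq_adjoint, ContinuousLinearMap.eq_adjoint_iff]
    intro x y
    simp [diagOp_apply, map_star, ContinuousLinearMap.star_eq_adjoint,
      ContinuousLinearMap.adjoint_inner_left]

end DirectSum

/-! ### Spectral triples -/

section Triples

variable {A : Type u} [CStarAlgebra A]

/-- `(𝒜, H, D)`, with the representation `π` of `A` on `H`, is an odd spectral triple on the
separable unital C⋆-algebra `A`. -/
structure IsOddSpectralTriple {H : Type v} [NormedAddCommGroup H] [InnerProductSpace ℂ H]
    [CompleteSpace H] (𝒜 : NonUnitalStarSubalgebra ℂ A) (π : A →⋆ₐ[ℂ] (H →L[ℂ] H))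
    (D : H →ₗ.[ℂ] H) : Prop where
  separable : TopologicalSpace.SeparableSpace A
  dense : Dense (𝒜 : Set A)
  dense_domain : Dense (D.domain : Set H)
  selfAdjoint : IsSelfAdjoint D
  compact : HasCompactResolvent D
  commutator : ∀ a ∈ 𝒜, ∃ T : H →L[ℂ] H, IsCommutator D (π a) T

/-- `(𝒜, H₀ ⊕ H₁, D)` is an even spectral triple on `A`: the representation is diagonal and
`D = [[0, D₀], [D₀†, 0]]` with respect to the given decomposition. -/
structure IsEvenSpectralTriple {H₀ : Type v} [NormedAddCommGroup H₀] [InnerProductSpace ℂ H₀]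
    [CompleteSpace H₀] {H₁ : Type w} [NormedAddCommGroup H₁] [InnerProductSpace ℂ H₁]
    [CompleteSpace H₁] (𝒜 : NonUnitalStarSubalgebra ℂ A)
    (π : A →⋆ₐ[ℂ] (WithLp 2 (H₀ × H₁) →L[ℂ] WithLp 2 (H₀ × H₁)))
    (D : WithLp 2 (H₀ × H₁) →ₗ.[ℂ] WithLp 2 (H₀ × H₁)) : Prop
    extends IsOddSpectralTriple 𝒜 π D where
  graded_rep : ∃ (π₀ : A →⋆ₐ[ℂ] (H₀ →L[ℂ] H₀)) (π₁ : A →⋆ₐ[ℂ] (H₁ →L[ℂ] H₁)), π = diagRep π₀ π₁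
  graded_dirac : ∃ D₀ : H₁ →ₗ.[ℂ] H₀, Dense (D₀.domain : Set H₁) ∧ D = offDiag D₀ D₀†

/-- Non-degeneracy: the representation is faithful, and for `a ∈ 𝒜` one has `[D, π(a)] = 0` if and
only if `a ∈ ℂ1`. -/
structure IsNondegenerate {H : Type v} [NormedAddCommGroup H] [InnerProductSpace ℂ H]
    [CompleteSpace H] (𝒜 : NonUnitalStarSubalgebra ℂ A) (π : A →⋆ₐ[ℂ] (H →L[ℂ] H))
    (D : H →ₗ.[ℂ] H) : Prop where
  faithful : Function.Injective π
  scalar : ∀ a ∈ 𝒜, IsCommutator D (π a) 0 ↔ ∃ c : ℂ, a = c • (1 : A)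

end Triples

/-! ### Operators on `H ⊗ ℓ²(Γ) = ℓ²(Γ; H)`

The Hilbert space `H ⊗ ℓ²(Γ)` is realized as `ℓ²(Γ; H)`, where `ξ ⊗ δ_g` is the function with value
`ξ` at `g` and `0` elsewhere. -/

/-- A proper translation bounded function on the group `Γ`. -/
structure IsProperTranslationBounded {Γ : Type u} [Group Γ] (l : Γ → ℤ) : Prop where
  eq_zero_iff : ∀ g, l g = 0 ↔ g = 1
  finite_level : ∀ n : ℤ, {g | l g = n}.Finite
  bounded : ∀ g, ∃ C : ℤ, ∀ x, |l x - l (g⁻¹ * x)| ≤ C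

section EllTwo

variable (Γ : Type u) (H : Type v) [NormedAddCommGroup H] [InnerProductSpace ℂ H]

/-- The Hilbert space `ℓ²(Γ; H) = H ⊗ ℓ²(Γ)`. -/
abbrev EllTwo : Type (max u v) := lp (fun _ : Γ => H) 2

variable {Γ H}

/-- The direct sum `⨁_g T_g` of a family of (possibly unbounded) operators on `H`, acting
coordinatewise on `ℓ²(Γ; H)` with its natural domain: all `ξ` with `ξ_g ∈ dom T_g` for all `g` and
`∑_g ‖T_g ξ_g‖² < ∞`. -/
def sumOp (T : Γ → (H →ₗ.[ℂ] H)) : EllTwo Γ H →ₗ.[ℂ] EllTwo Γ H where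
  domain :=
    { carrier := {x | ∃ h : ∀ g, x g ∈ (T g).domain, Memℓp (fun g => T g ⟨x g, h g⟩) 2}
      add_mem' := by
        rintro x y ⟨hx, hx'⟩ ⟨hy, hy'⟩
        refine ⟨fun g => add_mem (hx g) (hy g), ?_⟩
        convert hx'.add hy' using 1
        funext g
        exact (T g).map_add ⟨x g, hx g⟩ ⟨y g, hy g⟩
      zero_mem' := by
        refine ⟨fun g => zero_mem _, ?_⟩
        convert (zero_memℓp : Memℓp (0 : Γ → H) 2) using 1
        funext g
        exact (T g).map_zero
      smul_mem' := by
        rintro c x ⟨hx, hx'⟩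
        refine ⟨fun g => Submodule.smul_mem _ c (hx g), ?_⟩
        convert hx'.const_smul c using 1
        funext g
        exact (T g).map_smul c ⟨x g, hx g⟩ }
  toFun :=
    { toFun := fun x => ⟨fun g => T g ⟨(x : EllTwo Γ H) g, x.2.1 g⟩, x.2.2⟩
      map_add' := fun x y => by
        apply lp.ext
        funext g
        exact (T g).map_add ⟨(x : EllTwo Γ H) g, x.2.1 g⟩ ⟨(y : EllTwo Γ H) g, y.2.1 g⟩
      map_smul' := fun c x => by
        apply lp.ext
        funext g
        exact (T g).map_smul c ⟨(x : EllTwo Γ H) g, x.2.1 g⟩ }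

/-- The operator `D ⊗ 1` on `H ⊗ ℓ²(Γ)`. -/
def tensorOne (D : H →ₗ.[ℂ] H) : EllTwo Γ H →ₗ.[ℂ] EllTwo Γ H :=
  sumOp fun _ => D

variable (H) in
/-- The operator `1 ⊗ M_l` on `H ⊗ ℓ²(Γ)`: multiplication by the function `l`, with domain all `ξ`
with `∑_g ‖l(g) ξ_g‖² < ∞`. For `H = ℂ` this is the operator `M_l` on `ℓ²(Γ)`. -/
def mulOp (l : Γ → ℤ) : EllTwo Γ H →ₗ.[ℂ] EllTwo Γ H :=
  sumOp fun g => LinearMap.toPMap ((l g : ℂ) • LinearMap.id) ⊤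

/-- The Dirac operator `[[0, D_A ⊗ 1 - i ⊗ M_l], [D_A ⊗ 1 + i ⊗ M_l, 0]]`. -/
def crossedDirac (D : H →ₗ.[ℂ] H) (l : Γ → ℤ) :
    WithLp 2 (EllTwo Γ H × EllTwo Γ H) →ₗ.[ℂ] WithLp 2 (EllTwo Γ H × EllTwo Γ H) :=
  offDiag (tensorOne D - Complex.I • mulOp H l) (tensorOne D + Complex.I • mulOp H l)

/-- The bounded operator `⨁_g T_g` on `ℓ²(Γ; H)`, for `T_g` bounded uniformly in `g`. -/
def boundedSum (T : Γ → (H →L[ℂ] H)) (C : ℝ) (hC : ∀ g, ‖T g‖ ≤ C) : EllTwo Γ H →L[ℂ] EllTwo Γ H :=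
  have hle : ∀ (x : EllTwo Γ H) (g : Γ), ‖T g (x g)‖ ≤ ‖((C : ℂ) • x : EllTwo Γ H) g‖ := fun x g => by
    have h0 : 0 ≤ C := (norm_nonneg _).trans (hC g)
    rw [lp.coeFn_smul, Pi.smul_apply, norm_smul, Complex.norm_real, Real.norm_of_nonneg h0]
    exact (T g).le_of_opNorm_le (hC g) (x g)
  have hmem : ∀ x : EllTwo Γ H, Memℓp (fun g => T g (x g)) 2 := fun x =>
    (lp.memℓp ((C : ℂ) • x : EllTwo Γ H)).mono' (hle x)
  LinearMap.mkContinuous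
    { toFun := fun x => (⟨fun g => T g (x g), hmem x⟩ : EllTwo Γ H)
      map_add' := fun x y => lp.ext <| funext fun g => (T g).map_add (x g) (y g)
      map_smul' := fun c x => lp.ext <| funext fun g => (T g).map_smul c (x g) }
    |C| (fun x => by
      rw [← Real.norm_eq_abs, ← Complex.norm_real, ← norm_smul]
      exact lp.norm_mono two_ne_zero (hle x))

theorem boundedSum_apply (T : Γ → (H →L[ℂ] H)) (C : ℝ) (hC : ∀ g, ‖T g‖ ≤ C) (x : EllTwo Γ H)
    (g : Γ) : boundedSum T C hC x g = T g (x g) := rfl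

end EllTwo

/-! ### The reduced crossed product -/

section CrossedProduct

variable {A : Type u} [CStarAlgebra A] {H : Type v} [NormedAddCommGroup H] [InnerProductSpace ℂ H]
  [CompleteSpace H] {Γ : Type w} [Group Γ]

/-- The representation `π̃` of `A` on `H ⊗ ℓ²(Γ)`, `π̃(a)(ξ ⊗ δ_g) = π(α_{g⁻¹}(a)) ξ ⊗ δ_g`. -/
def coeffRep (π : A →⋆ₐ[ℂ] (H →L[ℂ] H)) (α : Γ →* (A ≃⋆ₐ[ℂ] A)) :
    A →⋆ₐ[ℂ] (EllTwo Γ H →L[ℂ] EllTwo Γ H) where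
  toFun a := boundedSum (fun g => π (α g⁻¹ a)) ‖a‖ fun g =>
    (NonUnitalStarAlgHom.norm_apply_le π _).trans (StarAlgEquiv.norm_map (α g⁻¹) a).le
  map_one' := by ext x g; simp [boundedSum_apply]
  map_mul' a b := by ext x g; simp [boundedSum_apply]
  map_zero' := by ext x g; simp [boundedSum_apply]
  map_add' a b := by ext x g; simp [boundedSum_apply]
  commutes' c := by
    ext x g; simp [boundedSum_apply, Algebra.algebraMap_eq_smul_one]
  map_star' a := by
    rw [ContinuousLinearMap.star_eq_adjoint, ContinuousLinearMap.eq_adjoint_iff]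
    intro x y
    rw [lp.inner_eq_tsum, lp.inner_eq_tsum]
    refine tsum_congr fun g => ?_
    simp [boundedSum_apply, map_star, ContinuousLinearMap.star_eq_adjoint,
      ContinuousLinearMap.adjoint_inner_left]

variable (H) in
/-- The operators `λ_h` on `H ⊗ ℓ²(Γ)`, `λ_h(ξ ⊗ δ_g) = ξ ⊗ δ_{hg}`. -/
def translation (h : Γ) : EllTwo Γ H →L[ℂ] EllTwo Γ H :=
  have hsum : ∀ x : EllTwo Γ H, Summable fun g => ‖x (h⁻¹ * g)‖ ^ (2 : ℝ≥0∞).toReal := fun x =>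
    (Equiv.mulLeft h⁻¹).summable_iff.mpr ((lp.memℓp x).summable (by simp))
  LinearMap.mkContinuous
    { toFun := fun x => (⟨fun g => x (h⁻¹ * g), memℓp_gen (hsum x)⟩ : EllTwo Γ H)
      map_add' := fun _ _ => rfl
      map_smul' := fun _ _ => rfl }
    1 (fun x => by
      rw [one_mul]
      refine lp.norm_le_of_tsum_le (by simp) (norm_nonneg _) ?_
      rw [lp.norm_rpow_eq_tsum (by simp) x]
      exact ((Equiv.mulLeft h⁻¹).tsum_eq fun g => ‖x g‖ ^ (2 : ℝ≥0∞).toReal).le)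

theorem translation_apply (h : Γ) (x : EllTwo Γ H) (g : Γ) :
    translation H h x g = x (h⁻¹ * g) := rfl

theorem coeffRep_apply (π : A →⋆ₐ[ℂ] (H →L[ℂ] H)) (α : Γ →* (A ≃⋆ₐ[ℂ] A)) (a : A)
    (x : EllTwo Γ H) (g : Γ) : coeffRep π α a x g = π (α g⁻¹ a) (x g) := rfl

theorem translation_one : translation H (1 : Γ) = 1 := by
  ext x g; simp [translation_apply]

theorem translation_mul (g h : Γ) : translation H g * translation H h = translation H (g * h) := by
  ext x k; simp [translation_apply, mul_assoc]

theorem star_translation (h : Γ) : star (translation H h) = translation H h⁻¹ := by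
  symm
  rw [ContinuousLinearMap.star_eq_adjoint, ContinuousLinearMap.eq_adjoint_iff]
  intro x y
  rw [lp.inner_eq_tsum, lp.inner_eq_tsum,
    ← (Equiv.mulLeft h⁻¹).tsum_eq fun g => ⟪translation H h⁻¹ x g, y g⟫_ℂ]
  refine tsum_congr fun g => ?_
  simp [translation_apply]

theorem translation_mul_coeffRep (π : A →⋆ₐ[ℂ] (H →L[ℂ] H)) (α : Γ →* (A ≃⋆ₐ[ℂ] A)) (h : Γ) (a : A) :
    translation H h * coeffRep π α a = coeffRep π α (α h a) * translation H h := by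
  ext x g
  simp [translation_apply, coeffRep_apply, ← StarAlgEquiv.mul_apply, -map_inv, ← map_mul]

/-- The reduced crossed product `A ⋊_{r,α} Γ`, as the C⋆-algebra of operators on `H ⊗ ℓ²(Γ)`
generated by `π̃(A)` and the `λ_g` (for a faithful representation `π` of `A` on `H`). -/
def reducedCrossedProduct (π : A →⋆ₐ[ℂ] (H →L[ℂ] H)) (α : Γ →* (A ≃⋆ₐ[ℂ] A)) :
    StarSubalgebra ℂ (EllTwo Γ H →L[ℂ] EllTwo Γ H) :=
  (StarAlgebra.adjoin ℂ
    (Set.range (coeffRep π α) ∪ Set.range (translation H : Γ → _))).topologicalClosure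

instance isClosed_reducedCrossedProduct (π : A →⋆ₐ[ℂ] (H →L[ℂ] H)) (α : Γ →* (A ≃⋆ₐ[ℂ] A)) :
    IsClosed (reducedCrossedProduct π α : Set (EllTwo Γ H →L[ℂ] EllTwo Γ H)) :=
  StarSubalgebra.isClosed_topologicalClosure _

/-- The operator `X` is a finite sum `∑_g x_g λ_g` with all coefficients `x_g` in `𝒜`. -/
def IsFiniteSum (𝒜 : NonUnitalStarSubalgebra ℂ A) (π : A →⋆ₐ[ℂ] (H →L[ℂ] H))
    (α : Γ →* (A ≃⋆ₐ[ℂ] A)) (X : EllTwo Γ H →L[ℂ] EllTwo Γ H) : Prop :=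
  ∃ (s : Finset Γ) (x : Γ → A), (∀ g, x g ∈ 𝒜) ∧
    X = ∑ g ∈ s, coeffRep π α (x g) * translation H g

section FiniteSums

variable {𝒜 : NonUnitalStarSubalgebra ℂ A} {π : A →⋆ₐ[ℂ] (H →L[ℂ] H)} {α : Γ →* (A ≃⋆ₐ[ℂ] A)}

theorem IsFiniteSum.zero : IsFiniteSum 𝒜 π α 0 :=
  ⟨∅, fun _ => 0, fun _ => zero_mem _, by simp⟩

theorem IsFiniteSum.single {a : A} (ha : a ∈ 𝒜) (g : Γ) :
    IsFiniteSum 𝒜 π α (coeffRep π α a * translation H g) :=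
  ⟨{g}, fun _ => a, fun _ => ha, by simp⟩

theorem IsFiniteSum.add {X Y : EllTwo Γ H →L[ℂ] EllTwo Γ H} (hX : IsFiniteSum 𝒜 π α X)
    (hY : IsFiniteSum 𝒜 π α Y) : IsFiniteSum 𝒜 π α (X + Y) := by
  classical
  obtain ⟨s, x, hx, rfl⟩ := hX
  obtain ⟨t, y, hy, rfl⟩ := hY
  refine ⟨s ∪ t, fun g => (if g ∈ s then x g else 0) + (if g ∈ t then y g else 0), fun g => ?_, ?_⟩
  · refine add_mem ?_ ?_ <;> split_ifs
    exacts [hx g, zero_mem _, hy g, zero_mem _]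
  · simp only [map_add, add_mul, Finset.sum_add_distrib]
    congr 1
    · rw [← Finset.sum_subset Finset.subset_union_left]
      · exact Finset.sum_congr rfl fun g hg => by simp [hg]
      · intro g _ hg
        simp [hg]
    · rw [← Finset.sum_subset Finset.subset_union_right]
      · exact Finset.sum_congr rfl fun g hg => by simp [hg]
      · intro g _ hg
        simp [hg]

theorem IsFiniteSum.sum {ι : Type*} (s : Finset ι) {X : ι → (EllTwo Γ H →L[ℂ] EllTwo Γ H)}
    (hX : ∀ i, IsFiniteSum 𝒜 π α (X i)) : IsFiniteSum 𝒜 π α (∑ i ∈ s, X i) :=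
  Finset.sum_induction X _ (fun _ _ => IsFiniteSum.add) IsFiniteSum.zero fun i _ => hX i

theorem IsFiniteSum.smul (c : ℂ) {X : EllTwo Γ H →L[ℂ] EllTwo Γ H} (hX : IsFiniteSum 𝒜 π α X) :
    IsFiniteSum 𝒜 π α (c • X) := by
  obtain ⟨s, x, hx, rfl⟩ := hX
  exact ⟨s, fun g => c • x g, fun g => SMulMemClass.smul_mem c (hx g), by
    simp [Finset.smul_sum, map_smul]⟩

theorem IsFiniteSum.mul (hα : ∀ g, ∀ a ∈ 𝒜, α g a ∈ 𝒜) {X Y : EllTwo Γ H →L[ℂ] EllTwo Γ H}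
    (hX : IsFiniteSum 𝒜 π α X) (hY : IsFiniteSum 𝒜 π α Y) : IsFiniteSum 𝒜 π α (X * Y) := by
  obtain ⟨s, x, hx, rfl⟩ := hX
  obtain ⟨t, y, hy, rfl⟩ := hY
  rw [Finset.sum_mul_sum]
  refine IsFiniteSum.sum _ fun g => IsFiniteSum.sum _ fun h => ?_
  have key : coeffRep π α (x g) * translation H g * (coeffRep π α (y h) * translation H h) =
      coeffRep π α (x g * α g (y h)) * translation H (g * h) := by
    rw [map_mul, ← translation_mul, mul_assoc, ← mul_assoc (translation H g),
      translation_mul_coeffRep]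
    simp only [mul_assoc]
  rw [key]
  exact IsFiniteSum.single (mul_mem (hx g) (hα g _ (hy h))) _

theorem IsFiniteSum.star (hα : ∀ g, ∀ a ∈ 𝒜, α g a ∈ 𝒜) {X : EllTwo Γ H →L[ℂ] EllTwo Γ H}
    (hX : IsFiniteSum 𝒜 π α X) : IsFiniteSum 𝒜 π α (star X) := by
  obtain ⟨s, x, hx, rfl⟩ := hX
  rw [star_sum]
  refine IsFiniteSum.sum _ fun g => ?_
  rw [star_mul, star_translation, ← map_star, translation_mul_coeffRep]
  exact IsFiniteSum.single (hα _ _ (star_mem (hx g))) _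

end FiniteSums

/-- The `*`-subalgebra `C_c(Γ, 𝒜)` of `A ⋊_{r,α} Γ`, consisting of the finite sums `∑_g x_g λ_g`
with all coefficients `x_g` in `𝒜`. -/
def finiteSums (𝒜 : NonUnitalStarSubalgebra ℂ A) (π : A →⋆ₐ[ℂ] (H →L[ℂ] H))
    (α : Γ →* (A ≃⋆ₐ[ℂ] A)) (hα : ∀ g, ∀ a ∈ 𝒜, α g a ∈ 𝒜) :
    NonUnitalStarSubalgebra ℂ (reducedCrossedProduct π α) where
  carrier := {X | IsFiniteSum 𝒜 π α (X : EllTwo Γ H →L[ℂ] EllTwo Γ H)}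
  add_mem' hX hY := IsFiniteSum.add hX hY
  zero_mem' := IsFiniteSum.zero
  mul_mem' hX hY := IsFiniteSum.mul hα hX hY
  smul_mem' c _ hX := IsFiniteSum.smul c hX
  star_mem' hX := IsFiniteSum.star hα hX

/-- The representation `x ↦ x ⊕ x` of `A ⋊_{r,α} Γ` on `(H ⊗ ℓ²(Γ)) ⊕ (H ⊗ ℓ²(Γ))`. -/
def crossedRep (π : A →⋆ₐ[ℂ] (H →L[ℂ] H)) (α : Γ →* (A ≃⋆ₐ[ℂ] A)) :
    reducedCrossedProduct π α →⋆ₐ[ℂ]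
      (WithLp 2 (EllTwo Γ H × EllTwo Γ H) →L[ℂ] WithLp 2 (EllTwo Γ H × EllTwo Γ H)) :=
  diagRep (reducedCrossedProduct π α).subtype (reducedCrossedProduct π α).subtype

end CrossedProduct

end CrossedTriple

end

/-! Since `D_A ⊗ 1` and `1 ⊗ M_l` act on different factors, the cross terms in the square of the
Dirac operator cancel, and `D²` is two copies of `D_A² ⊗ 1 + 1 ⊗ M_l²`. Hence `(1 + D²)⁻¹` is two
copies of the direct sum over `g` of `(1 + l(g)² + D_A²)⁻¹`, and each block is a function of `R = (1
+ D_A²)⁻¹`, namely `x ↦ x / (1 + c x)` with `c = l(g)²` (`shiftInv`, `sumShiftInv`). The analysis of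
`D` thus reduces to estimates on these blocks that are uniform in `c`.

(i) The direct sum solves `(1 + D²) y = x` for every `x` (`crossedDirac_solves`). A symmetric
operator for which this is always solvable is densely defined and self-adjoint
(`isSelfAdjoint_of_solves`), and self-adjointness of an off-diagonal matrix forces its entries to be
adjoint to each other. The blocks are compact with norm at most `(1 + l(g)²)⁻¹`, which tends to zero
because the level sets of `l` are finite, so their direct sum is compact. As `D_A ⊗ 1` commutes with
`λ_h` and `1 ⊗ M_l` with `π̃(a)`, the Leibniz rule leaves only the commutators `[D_A,
π(α_{g⁻¹}(a))]` and multiplication by `l(g) - l(h⁻¹g)`, both bounded uniformly in `g` by hypothesis.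

(ii) On `[0, 1]` one has `(x / (1 + c x)) ^ (s + t) ≤ (1 + c) ^ (-t) * x ^ s` (`rpow_shiftInv_le`).
With `s = p/2` and `t = q/2` the trace of `(1 + D²)^{-(p+q)/2}` is at most twice the product of the
traces of `(1 + D_A²)^{-p/2}` and `(1 + M_l²)^{-q/2}`.

(iii) Apply the vanishing commutator of `∑ x_g λ_g` to `ξ ⊗ δ_1` and read the coordinate at `g`. The
equations for the signs `±i` differ by a nonzero multiple of `l(g) π(α_{g⁻¹}(x_g)) ξ`, so `x_g = 0`
for `g ≠ 1`. What remains is `[D_A, π(x_1)] = 0`, and `x_1` is scalar. -/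

noncomputable section

namespace CrossedTriple

/-! ### Intertwining of fractional powers -/

section Intertwine

variable {H : Type*} [NormedAddCommGroup H] [InnerProductSpace ℂ H] [CompleteSpace H]
  {K : Type*} [NormedAddCommGroup K] [InnerProductSpace ℂ K] [CompleteSpace K]

/-- The pairs of operators that are intertwined, together with their adjoints, by `J`. -/
def intertwiners (J : H →L[ℂ] K) : StarSubalgebra ℂ ((K →L[ℂ] K) × (H →L[ℂ] H)) where
  carrier := {p | p.1 ∘L J = J ∘L p.2 ∧ star p.1 ∘L J = J ∘L star p.2}
  mul_mem' := by
    rintro ⟨a, b⟩ ⟨c, d⟩ ⟨h₁, h₂⟩ ⟨h₃, h₄⟩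
    simp only [ContinuousLinearMap.ext_iff, ContinuousLinearMap.comp_apply] at h₁ h₂ h₃ h₄
    constructor <;> ext x <;> simp [h₁, h₂, h₃, h₄]
  add_mem' := by
    rintro ⟨a, b⟩ ⟨c, d⟩ ⟨h₁, h₂⟩ ⟨h₃, h₄⟩
    simp only [ContinuousLinearMap.ext_iff, ContinuousLinearMap.comp_apply] at h₁ h₂ h₃ h₄
    constructor <;> ext x <;> simp [h₁, h₂, h₃, h₄]
  algebraMap_mem' c := by
    constructor <;> ext x <;> simp [Algebra.algebraMap_eq_smul_one]
  star_mem' := by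
    rintro ⟨a, b⟩ ⟨h₁, h₂⟩
    exact ⟨h₂, by simpa using h₁⟩

instance isClosed_intertwiners (J : H →L[ℂ] K) :
    IsClosed (intertwiners J : Set ((K →L[ℂ] K) × (H →L[ℂ] H))) := by
  refine IsClosed.inter (isClosed_eq ?_ ?_) (isClosed_eq ?_ ?_)
  · exact continuous_fst.clm_comp continuous_const
  · exact continuous_const.clm_comp continuous_snd
  · exact (continuous_star.comp continuous_fst).clm_comp continuous_const
  · exact continuous_const.clm_comp (continuous_star.comp continuous_snd)

/-- The pair `(a, b)` lies in the closed star subalgebra `intertwiners J`, hence so does its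
functional calculus, which is computed componentwise. -/
theorem cfc_comp_of_comp_eq {a : K →L[ℂ] K} {b : H →L[ℂ] H} (ha : IsSelfAdjoint a)
    (hb : IsSelfAdjoint b) {J : H →L[ℂ] K} (h : a ∘L J = J ∘L b) {f : ℝ → ℝ}
    (hf : Continuous f) : cfc f a ∘L J = J ∘L cfc f b := by
  have hmem : (a, b) ∈ intertwiners J := ⟨h, by rw [ha.star_eq, hb.star_eq]; exact h⟩
  -- The subalgebra is complex, so `f` is extended to `ℂ` through the real part; this changes
  -- nothing on the real spectra of `a` and `b`.
  have hg : Continuous fun x : ℂ => (f x.re : ℂ) := by fun_prop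
  have hn : IsStarNormal ((a, b) : (K →L[ℂ] K) × (H →L[ℂ] H)) :=
    IsSelfAdjoint.isStarNormal (Prod.ext ha hb)
  have key := (cfc_mem (s := intertwiners J) (fun x : ℂ => (f x.re : ℂ)) hmem)
  rw [cfc_map_prod (S := ℂ) _ a b hg.continuousOn hn ha.isStarNormal hb.isStarNormal] at key
  rw [cfc_real_eq_complex f ha, cfc_real_eq_complex f hb]
  exact key.1

theorem rpow_comp_of_comp_eq {a : K →L[ℂ] K} {b : H →L[ℂ] H} (ha : 0 ≤ a) (hb : 0 ≤ b)
    {J : H →L[ℂ] K} (h : a ∘L J = J ∘L b) {s : ℝ} (hs : 0 ≤ s) :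
    (a ^ s) ∘L J = J ∘L (b ^ s) := by
  rw [CFC.rpow_eq_cfc_real ha, CFC.rpow_eq_cfc_real hb]
  exact cfc_comp_of_comp_eq ha.isSelfAdjoint hb.isSelfAdjoint h (Real.continuous_rpow_const hs)

end Intertwine

/-! ### Compactness of square roots -/

section SquareRoot

variable {H : Type*} [NormedAddCommGroup H] [InnerProductSpace ℂ H] [CompleteSpace H]

/-- Because `‖S x‖² = ⟪S² x, x⟫ ≤ ‖S² x‖ ‖x‖`, a finite net for the image of the unit ball under
`S²` yields one for its image under `S`. -/
theorem isCompactOperator_of_comp_self {S : H →L[ℂ] H} (hS : IsSelfAdjoint S)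
    (h : IsCompactOperator (S * S)) : IsCompactOperator S := by
  have hsq : ∀ x, ‖S x‖ ^ 2 ≤ ‖(S * S) x‖ * ‖x‖ := fun x => by
    have h1 : ⟪S x, S x⟫_ℂ = ⟪(S * S) x, x⟫_ℂ := by
      change _ = ⟪S (S x), x⟫_ℂ
      conv_rhs => rw [← hS.adjoint_eq]
      rw [ContinuousLinearMap.adjoint_inner_left, hS.adjoint_eq]
    rw [← inner_self_eq_norm_sq (𝕜 := ℂ), h1]
    exact (RCLike.re_le_norm _).trans (norm_inner_le_norm _ _)
  refine (isCompactOperator_iff_isCompact_closure_image_closedBall (S : H →ₗ[ℂ] H)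
    zero_lt_one).2 ?_
  refine TotallyBounded.isCompact_of_isClosed (TotallyBounded.closure ?_) isClosed_closure
  have htb : TotallyBounded ((S * S : H →L[ℂ] H) '' Metric.closedBall 0 1) :=
    (((isCompactOperator_iff_isCompact_closure_image_closedBall ((S * S : H →L[ℂ] H) : H →ₗ[ℂ] H)
      zero_lt_one).1 h).totallyBounded).subset subset_closure
  rw [Metric.totallyBounded_iff]
  intro ε hε
  -- Two points of the unit ball differ by at most `2` in norm, so `ε² / 2` for `S²` becomes `ε²`
  -- for `‖S (x - z)‖²`.
  obtain ⟨t, hts, htf, hcov⟩ := Metric.finite_approx_of_totallyBounded htb (ε ^ 2 / 2)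
    (by positivity)
  refine ⟨S '' (Function.invFunOn (S * S : H →L[ℂ] H) (Metric.closedBall 0 1) '' t),
    (htf.image _).image _, ?_⟩
  rintro _ ⟨x, hx, rfl⟩
  obtain ⟨y, hy, hxy⟩ := Set.mem_iUnion₂.1 (hcov (Set.mem_image_of_mem _ hx))
  set z := Function.invFunOn (S * S : H →L[ℂ] H) (Metric.closedBall 0 1) y with hz
  have hzB : z ∈ Metric.closedBall (0 : H) 1 := Function.invFunOn_mem (hts hy)
  have hzy : (S * S) z = y := Function.invFunOn_eq (hts hy)
  refine Set.mem_iUnion₂.2 ⟨S z, ⟨z, ⟨y, hy, rfl⟩, rfl⟩, ?_⟩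
  rw [Metric.mem_ball, dist_eq_norm] at hxy ⊢
  rw [mem_closedBall_zero_iff] at hx hzB
  rw [← hzy, ← map_sub] at hxy
  change ‖S x - S z‖ < ε
  rw [← map_sub]
  have hxz : ‖x - z‖ ≤ 2 := (norm_sub_le _ _).trans (by linarith)
  have h1 := hsq (x - z)
  refine lt_of_pow_lt_pow_left₀ 2 hε.le ?_
  nlinarith [norm_nonneg ((S * S) (x - z))]

theorem isCompactOperator_rpow_half {R : H →L[ℂ] H} (hR : 0 ≤ R) (h : IsCompactOperator R) :
    IsCompactOperator (R ^ (1 / 2 : ℝ)) := by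
  refine isCompactOperator_of_comp_self CFC.rpow_nonneg.isSelfAdjoint ?_
  rwa [← CFC.sqrt_eq_rpow, CFC.sqrt_mul_sqrt_self R]

theorem isCompactOperator_of_rpow_half {R : H →L[ℂ] H} (hR : 0 ≤ R)
    (h : IsCompactOperator (R ^ (1 / 2 : ℝ))) : IsCompactOperator R := by
  rw [← CFC.sqrt_mul_sqrt_self R, CFC.sqrt_eq_rpow]
  exact h.clm_comp _

end SquareRoot

/-! ### Trace class operators and Parseval frames -/

section Trace

variable {H : Type*} [NormedAddCommGroup H] [InnerProductSpace ℂ H]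

/-- The family `v` satisfies Parseval's identity. -/
def IsParseval {κ : Type*} (v : κ → H) : Prop :=
  ∀ x, ∑' j, ‖⟪v j, x⟫_ℂ‖ₑ ^ 2 = ‖x‖ₑ ^ 2

theorem _root_.HilbertBasis.isParseval {κ : Type*} (e : HilbertBasis κ ℂ H) :
    IsParseval e := fun x => by
  have h := e.hasSum_inner_mul_inner x x
  have h2 : HasSum (fun i => ‖⟪e i, x⟫_ℂ‖ ^ 2) (‖x‖ ^ 2) := by
    have := Complex.hasSum_re h
    convert this using 1
    · funext i
      rw [← inner_conj_symm x (e i), ← Complex.normSq_eq_conj_mul_self, Complex.ofReal_re,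
        Complex.normSq_eq_norm_sq]
    · exact (inner_self_eq_norm_sq (𝕜 := ℂ) x).symm
  have h3 := ENNReal.ofReal_tsum_of_nonneg (fun i => by positivity) h2.summable
  rw [h2.tsum_eq] at h3
  simpa [← ofReal_norm, ENNReal.ofReal_pow] using h3.symm

omit [InnerProductSpace ℂ H] in
theorem summable_norm_sq_iff {κ : Type*} (f : κ → H) :
    (Summable fun j => ‖f j‖ ^ 2) ↔ ∑' j, ‖f j‖ₑ ^ 2 ≠ ∞ := by
  have := ENNReal.tsum_coe_ne_top_iff_summable_coe (f := fun j => ‖f j‖₊ ^ 2)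
  push_cast at this
  exact this.symm

variable [CompleteSpace H]

/-- With `S = √T`, both `∑ ‖S e_i‖²` and `∑ ‖S v_j‖²` expand to the double sum of `|⟪v_j, S e_i⟫|²`,
and sums in `[0, ∞]` may be exchanged. One convenient Parseval family therefore controls every
Hilbert basis. -/
theorem isTraceClass_of_isParseval {T : H →L[ℂ] H} (hT : 0 ≤ T) {κ : Type*} {v : κ → H}
    (hv : IsParseval v) (hs : Summable fun j => (⟪v j, T (v j)⟫_ℂ).re) : IsTraceClass T := by
  intro ι e
  rw [CFC.abs_of_nonneg T hT]
  set S := CFC.sqrt T with hSdef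
  have hS : IsSelfAdjoint S := (CFC.sqrt_nonneg T).isSelfAdjoint
  have hSS : ∀ x, T x = S (S x) := fun x => by
    conv_lhs => rw [← CFC.sqrt_mul_sqrt_self T]
    rfl
  have hsymm : ∀ x y, ⟪x, S y⟫_ℂ = ⟪S x, y⟫_ℂ := fun x y => by
    rw [← ContinuousLinearMap.adjoint_inner_left, hS.adjoint_eq]
  have hin : ∀ x, (⟪x, T x⟫_ℂ).re = ‖S x‖ ^ 2 := fun x => by
    rw [hSS, hsymm]
    exact inner_self_eq_norm_sq (𝕜 := ℂ) (S x)
  simp only [hin] at hs ⊢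
  have hswap : ∑' i, ‖S (e i)‖ₑ ^ 2 = ∑' j, ‖S (v j)‖ₑ ^ 2 := by
    simp_rw [← hv (S (e _)), ← e.isParseval (S (v _)), hsymm]
    rw [ENNReal.tsum_comm]
    refine tsum_congr fun j => tsum_congr fun i => ?_
    rw [← hsymm, ← inner_conj_symm]
    simp only [enorm, RCLike.nnnorm_conj]
  rwa [summable_norm_sq_iff, hswap, ← summable_norm_sq_iff]

end Trace

/-! ### Symmetric operators with a resolvent -/

section Symmetric

variable {H : Type*} [NormedAddCommGroup H] [InnerProductSpace ℂ H]

theorem inner_self_eq_ofReal (z : H) : ⟪z, z⟫_ℂ = ((‖z‖ ^ 2 : ℝ) : ℂ) := by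
  rw [inner_self_eq_norm_sq_to_K]
  push_cast
  rfl

/-- `y` solves the equation `y + c y + D² y = x`. -/
def SolvesShifted (D : H →ₗ.[ℂ] H) (c : ℝ) (x y : H) : Prop :=
  ∃ (hy : y ∈ D.domain) (hDy : D ⟨y, hy⟩ ∈ D.domain),
    y + (c : ℂ) • y + D ⟨D ⟨y, hy⟩, hDy⟩ = x

theorem solvesShifted_zero_iff {D : H →ₗ.[ℂ] H} {x y : H} : SolvesShifted D 0 x y ↔
    ∃ (hy : y ∈ D.domain) (hDy : D ⟨y, hy⟩ ∈ D.domain), y + D ⟨D ⟨y, hy⟩, hDy⟩ = x := by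
  simp [SolvesShifted]

namespace SolvesShifted

variable {D : H →ₗ.[ℂ] H} {c : ℝ} {x y x' y' : H}

theorem sub (h : SolvesShifted D c x y) (h' : SolvesShifted D c x' y') :
    SolvesShifted D c (x - x') (y - y') := by
  obtain ⟨hy, hDy, rfl⟩ := h
  obtain ⟨hy', hDy', rfl⟩ := h'
  have e : D ⟨y - y', sub_mem hy hy'⟩ = D ⟨y, hy⟩ - D ⟨y', hy'⟩ := D.map_sub ⟨y, hy⟩ ⟨y', hy'⟩
  refine ⟨sub_mem hy hy', by rw [e]; exact sub_mem hDy hDy', ?_⟩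
  have e' : D ⟨D ⟨y - y', sub_mem hy hy'⟩, by rw [e]; exact sub_mem hDy hDy'⟩ =
      D ⟨D ⟨y, hy⟩, hDy⟩ - D ⟨D ⟨y', hy'⟩, hDy'⟩ :=
    (congrArg D (Subtype.ext e)).trans (D.map_sub ⟨_, hDy⟩ ⟨_, hDy'⟩)
  rw [e', smul_sub]
  abel

theorem inner_eq (hD : D.IsFormalAdjoint D) (h : SolvesShifted D c x y)
    (h' : SolvesShifted D c x' y') :
    ⟪y, x'⟫_ℂ = (1 + c) * ⟪y, y'⟫_ℂ + ⟪D ⟨y, h.1⟩, D ⟨y', h'.1⟩⟫_ℂ := by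
  obtain ⟨hy, hDy, rfl⟩ := h
  obtain ⟨hy', hDy', rfl⟩ := h'
  have := hD ⟨y, hy⟩ ⟨D ⟨y', hy'⟩, hDy'⟩
  simp only at this
  rw [inner_add_right, inner_add_right, inner_smul_right, ← this]
  ring

theorem re_inner_eq (hD : D.IsFormalAdjoint D) (h : SolvesShifted D c x y) :
    (⟪y, x⟫_ℂ).re = (1 + c) * ‖y‖ ^ 2 + ‖D ⟨y, h.1⟩‖ ^ 2 := by
  rw [inner_eq hD h h, inner_self_eq_ofReal, inner_self_eq_ofReal, ← Complex.ofReal_one,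
    ← Complex.ofReal_add, ← Complex.ofReal_mul, ← Complex.ofReal_add, Complex.ofReal_re]

/-- The equation is paired with `y` and Cauchy–Schwarz applied. The bounds on `y`, `D y` and `D² y`
below rest on this; their explicit dependence on `c` makes them uniform in `g` when `c = l(g)²`. -/
theorem energy_le (hD : D.IsFormalAdjoint D) (h : SolvesShifted D c x y) :
    (1 + c) * ‖y‖ ^ 2 + ‖D ⟨y, h.1⟩‖ ^ 2 ≤ ‖y‖ * ‖x‖ :=
  (re_inner_eq hD h).symm.le.trans ((Complex.re_le_norm _).trans (norm_inner_le_norm _ _))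

theorem norm_le (hD : D.IsFormalAdjoint D) (h : SolvesShifted D c x y) :
    (1 + c) * ‖y‖ ≤ ‖x‖ := by
  have := energy_le hD h
  rcases (norm_nonneg y).eq_or_lt with h0 | h0
  · simp [← h0]
  · refine le_of_mul_le_mul_left ?_ h0
    nlinarith [sq_nonneg ‖D ⟨y, h.1⟩‖]

theorem norm_sq_map_le (hD : D.IsFormalAdjoint D) (hc : 0 ≤ c) (h : SolvesShifted D c x y) :
    (1 + c) * ‖D ⟨y, h.1⟩‖ ^ 2 ≤ ‖x‖ ^ 2 := by
  have h1 := energy_le hD h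
  have h2 := norm_le hD h
  have h3 : ‖D ⟨y, h.1⟩‖ ^ 2 ≤ ‖y‖ * ‖x‖ := by
    nlinarith [mul_nonneg (add_nonneg zero_le_one hc) (sq_nonneg ‖y‖)]
  calc _ ≤ (1 + c) * (‖y‖ * ‖x‖) := by gcongr
    _ = ((1 + c) * ‖y‖) * ‖x‖ := by ring
    _ ≤ _ := by nlinarith [norm_nonneg x]

theorem norm_map_map_le (hD : D.IsFormalAdjoint D) (hc : 0 ≤ c) (h : SolvesShifted D c x y) :
    ‖D ⟨D ⟨y, h.1⟩, h.2.1⟩‖ ≤ 2 * ‖x‖ := by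
  have h2 := norm_le hD h
  have h3 : D ⟨D ⟨y, h.1⟩, h.2.1⟩ = x - ((1 + c : ℝ) : ℂ) • y := by
    conv_rhs => rw [← h.2.2]
    push_cast
    rw [add_smul, one_smul]
    abel
  rw [h3]
  refine (norm_sub_le _ _).trans ?_
  rw [norm_smul, Complex.norm_real, Real.norm_of_nonneg (by positivity)]
  linarith

theorem eq_zero (hD : D.IsFormalAdjoint D) (hc : 0 ≤ c) (h : SolvesShifted D c x y)
    (hxy : ⟪y, x⟫_ℂ = 0) : x = 0 := by
  have h1 := re_inner_eq hD h
  rw [hxy, Complex.zero_re] at h1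
  have h2 : ‖y‖ = 0 := by
    nlinarith [sq_nonneg ‖D ⟨y, h.1⟩‖, norm_nonneg y, mul_nonneg hc (sq_nonneg ‖y‖)]
  rw [norm_eq_zero] at h2
  have hD0 : ∀ z (hz : z ∈ D.domain), z = 0 → D ⟨z, hz⟩ = 0 := by
    rintro _ hz rfl
    exact D.map_zero
  rw [← h.2.2, hD0 _ _ (hD0 _ _ h2), h2]
  simp

end SolvesShifted

variable {D : H →ₗ.[ℂ] H} {R : H →L[ℂ] H}

theorem IsInvOneAddSq.solves (hR : IsInvOneAddSq D R) (x : H) : SolvesShifted D 0 x (R x) :=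
  solvesShifted_zero_iff.2 ((hR x (R x)).1 rfl)

theorem isInvOneAddSq_of_solves (hD : D.IsFormalAdjoint D)
    (hR : ∀ x, SolvesShifted D 0 x (R x)) : IsInvOneAddSq D R := by
  intro x y
  rw [← solvesShifted_zero_iff]
  refine ⟨fun h => h ▸ hR x, fun h => ?_⟩
  have h1 := ((hR x).sub h).norm_le hD
  rw [sub_self, norm_zero, add_zero, one_mul, norm_le_zero_iff, sub_eq_zero] at h1
  exact h1

variable [CompleteSpace H]

/-- If `z` is orthogonal to the domain, it is orthogonal to the solution `y` of `y + D² y = z`; the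
energy identity then gives `y = 0` and `z = 0`. -/
theorem dense_domain_of_solves (hD : D.IsFormalAdjoint D)
    (hR : ∀ x, ∃ y, SolvesShifted D 0 x y) : Dense (D.domain : Set H) := by
  rw [Submodule.dense_iff_topologicalClosure_eq_top, Submodule.topologicalClosure_eq_top_iff,
    Submodule.eq_bot_iff]
  intro z hz
  obtain ⟨y, hy⟩ := hR z
  exact hy.eq_zero hD le_rfl ((Submodule.mem_orthogonal _ _).1 hz _ hy.1)

theorem isSelfAdjoint_of_solves (hD : D.IsFormalAdjoint D)
    (hR : ∀ x, ∃ y, SolvesShifted D 0 x y) : IsSelfAdjoint D := by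
  have hdense := dense_domain_of_solves hD hR
  have hle : D ≤ D† := hD.le_adjoint hdense
  -- `(D + ε)(D - ε) = D² + 1` when `ε² = -1`, so surjectivity of `1 + D²` passes to `D ± i`.
  have key : ∀ (ε : ℂ), ε * ε = -1 → ∀ x, ∃ t : D.domain, D t + ε • (t : H) = x := by
    intro ε hε x
    obtain ⟨y, hy, hDy, hyx⟩ := hR x
    refine ⟨⟨D ⟨y, hy⟩, hDy⟩ - ε • ⟨y, hy⟩, ?_⟩
    rw [D.map_sub, D.map_smul, ← hyx]
    simp only [Submodule.coe_sub, Submodule.coe_smul, smul_sub, smul_smul, hε]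
    simp
    abel
  rw [LinearPMap.isSelfAdjoint_def]
  refine le_antisymm ?_ hle
  have hdom : D†.domain ≤ D.domain := by
    intro y hy
    -- With `(D + i) t = (D† + i) y`, the vector `y - t` is in the kernel of `D† + i`, hence
    -- orthogonal to the range of `D - i`, which is the whole space.
    obtain ⟨t, ht⟩ := key Complex.I Complex.I_mul_I (D† ⟨y, hy⟩ + Complex.I • y)
    suffices h : y - t = 0 by rw [sub_eq_zero.1 h]; exact t.2
    obtain ⟨s, hs⟩ := key (-Complex.I) (by simp) (y - t)
    have h1 := LinearPMap.adjoint_isFormalAdjoint hdense ⟨y, hy⟩ s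
    have h2 := hD t s
    have h3 : D† ⟨y, hy⟩ = D t + Complex.I • (t : H) - Complex.I • y := by rw [ht]; abel
    have h4 : ⟪y - t, D s + -Complex.I • (s : H)⟫_ℂ = 0 := by
      rw [inner_add_right, inner_sub_left, inner_sub_left, ← h1, ← h2, h3]
      simp only [inner_add_left, inner_sub_left, inner_smul_left, inner_smul_right, Complex.conj_I]
      ring
    rwa [hs, inner_self_eq_zero] at h4
  exact ⟨hdom, fun _ _ hxy => (hle.2 hxy.symm).symm⟩

omit [CompleteSpace H] in
theorem IsInvOneAddSq.nonneg (hD : D.IsFormalAdjoint D) (hR : IsInvOneAddSq D R) : 0 ≤ R := by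
  rw [ContinuousLinearMap.nonneg_iff_isPositive, ContinuousLinearMap.isPositive_iff_complex]
  intro x
  have h := (hR.solves x).inner_eq hD (hR.solves x)
  rw [inner_self_eq_ofReal, inner_self_eq_ofReal, Complex.ofReal_zero, add_zero, one_mul,
    ← Complex.ofReal_add] at h
  have hpos : 0 ≤ ‖R x‖ ^ 2 + ‖D ⟨R x, (hR.solves x).1⟩‖ ^ 2 := by positivity
  rw [h]
  exact ⟨rfl, hpos⟩

omit [CompleteSpace H] in
theorem IsInvOneAddSq.norm_le_one (hD : D.IsFormalAdjoint D) (hR : IsInvOneAddSq D R) :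
    ‖R‖ ≤ 1 :=
  R.opNorm_le_bound zero_le_one fun x => by simpa using (hR.solves x).norm_le hD

end Symmetric

/-! ### The shifted resolvents `(1 + c + D²)⁻¹` -/

section Shift

open scoped NNReal

variable {H : Type*} [NormedAddCommGroup H] [InnerProductSpace ℂ H] [CompleteSpace H]

/-- `(c + R⁻¹)⁻¹`, that is, `(1 + c + D²)⁻¹` if `R = (1 + D²)⁻¹`. -/
def shiftInv (R : H →L[ℂ] H) (c : ℝ≥0) : H →L[ℂ] H :=
  cfc (fun x : ℝ≥0 => x / (1 + c * x)) R

theorem continuous_shift (c : ℝ≥0) : Continuous fun x : ℝ≥0 => x / (1 + c * x) :=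
  continuous_id.div (by fun_prop) fun x => by positivity

theorem shiftInv_nonneg (R : H →L[ℂ] H) (c : ℝ≥0) : 0 ≤ shiftInv R c :=
  cfc_predicate _ _

variable {R : H →L[ℂ] H}

theorem shiftInv_add (hR : 0 ≤ R) (c : ℝ≥0) :
    shiftInv R c + (c : ℂ) • (R * shiftInv R c) = R := by
  have hc := continuous_shift c
  have h1 : R * shiftInv R c = cfc (fun x : ℝ≥0 => x * (x / (1 + c * x))) R := by
    rw [cfc_mul (fun x => x) (fun x : ℝ≥0 => x / (1 + c * x)) R continuousOn_id hc.continuousOn,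
      cfc_id' ℝ≥0 R, shiftInv]
  have h2 : (c : ℂ) • (R * shiftInv R c) = c • (R * shiftInv R c) := rfl
  have h3 : Continuous fun x : ℝ≥0 => x * (x / (1 + c * x)) := continuous_id.mul hc
  rw [h2, h1, ← cfc_smul c (fun x : ℝ≥0 => x * (x / (1 + c * x))) R h3.continuousOn, shiftInv,
    ← cfc_add R _ (fun x : ℝ≥0 => c • (x * (x / (1 + c * x)))) hc.continuousOn
      (h3.const_smul c).continuousOn]
  conv_rhs => rw [← cfc_id' ℝ≥0 R]
  refine cfc_congr fun x _ => ?_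
  simp only [smul_eq_mul]
  field_simp

/-- Factoring out `R` puts the values in the domain of `D²`, where the equation of `R` can be used;
it also transfers compactness from `R`. -/
theorem shiftInv_apply_eq (hR : 0 ≤ R) (c : ℝ≥0) (x : H) :
    shiftInv R c x = R (x - (c : ℂ) • shiftInv R c x) := by
  conv_rhs => rw [map_sub, map_smul]
  have := congr($(shiftInv_add hR c) x)
  rw [← this]
  simp

theorem IsInvOneAddSq.shiftInv_solves {D : H →ₗ.[ℂ] H} (hD : D.IsFormalAdjoint D)
    (hR : IsInvOneAddSq D R) (c : ℝ≥0) (x : H) : SolvesShifted D c x (shiftInv R c x) := by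
  obtain ⟨hy, hDy, h⟩ := (hR _ _).1 (shiftInv_apply_eq (hR.nonneg hD) c x).symm
  refine ⟨hy, hDy, ?_⟩
  rw [add_right_comm, h]
  simp

theorem IsInvOneAddSq.norm_shiftInv_le {D : H →ₗ.[ℂ] H} (hD : D.IsFormalAdjoint D)
    (hR : IsInvOneAddSq D R) (c : ℝ≥0) : ‖shiftInv R c‖ ≤ (1 + c : ℝ)⁻¹ :=
  ContinuousLinearMap.opNorm_le_bound _ (by positivity) fun x => by
    rw [le_inv_mul_iff₀ (by positivity)]
    exact (hR.shiftInv_solves hD c x).norm_le hD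

theorem isCompactOperator_shiftInv (hR : 0 ≤ R) (h : IsCompactOperator R) (c : ℝ≥0) :
    IsCompactOperator (shiftInv R c) := by
  have : shiftInv R c = R ∘L (1 - (c : ℂ) • shiftInv R c) := by
    ext x
    rw [shiftInv_apply_eq hR]
    simp
  rw [this]
  exact h.comp_clm _

/-- The power is split in two: for `0 ≤ x ≤ 1` the number `x / (1 + c x)` is at most `1 / (1 + c)`,
used for the exponent `t`, and at most `x`, used for the exponent `s`. -/
theorem rpow_shiftInv_le (hR : 0 ≤ R) (hR1 : ‖R‖ ≤ 1) (c : ℝ≥0) {s t : ℝ} (hs : 0 < s)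
    (ht : 0 < t) : shiftInv R c ^ (s + t) ≤ ((1 + c) ^ (-t) : ℝ≥0) • R ^ s := by
  have hc := continuous_shift c
  have hpow : ∀ {r : ℝ}, 0 ≤ r → Continuous fun x : ℝ≥0 => x ^ r := fun hr =>
    NNReal.continuous_rpow_const hr
  rw [CFC.rpow_def, CFC.rpow_def, shiftInv, ← cfc_smul _ _ R (hpow hs.le).continuousOn,
    ← cfc_comp (fun x : ℝ≥0 => x ^ (s + t)) _ R hR (hpow (by positivity)).continuousOn
      hc.continuousOn]
  refine cfc_mono (fun x hx => ?_) ((hpow (by positivity)).comp hc).continuousOn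
    ((hpow hs.le).const_smul ((1 + c) ^ (-t) : ℝ≥0)).continuousOn
  -- The spectrum lies in `[0, 1]`. Only `‖1‖ ≤ 1` is available, since the space may be zero.
  have hx1 : x ≤ 1 := by
    have h1 := spectrum.norm_le_norm_mul_of_mem (spectrum.algebraMap_mem ℝ hx)
    have h2 : ‖(1 : H →L[ℂ] H)‖ ≤ 1 := ContinuousLinearMap.norm_id_le
    have h3 : ‖algebraMap ℝ≥0 ℝ x‖ = x := NNReal.norm_eq x
    rw [h3] at h1
    exact_mod_cast h1.trans (mul_le_one₀ hR1 (norm_nonneg _) h2)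
  simp only [Function.comp_apply, smul_eq_mul]
  rw [NNReal.rpow_add' (by positivity), mul_comm]
  gcongr
  · rw [NNReal.rpow_neg, ← NNReal.inv_rpow]
    gcongr
    rw [div_le_iff₀ (by positivity), inv_mul_eq_div, le_div_iff₀ (by positivity)]
    rw [mul_add, mul_one, mul_comm]
    gcongr
  · exact div_le_self zero_le (by simp)

end Shift

/-! ### Off-diagonal operators -/

section OffDiag

variable {H₀ : Type*} [NormedAddCommGroup H₀] [InnerProductSpace ℂ H₀]
  {H₁ : Type*} [NormedAddCommGroup H₁] [InnerProductSpace ℂ H₁]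
  {S : H₁ →ₗ.[ℂ] H₀} {T : H₀ →ₗ.[ℂ] H₁}

theorem offDiag_isFormalAdjoint (h : S.IsFormalAdjoint T) :
    (offDiag S T).IsFormalAdjoint (offDiag S T) := by
  rintro ⟨x, hx⟩ ⟨y, hy⟩
  rw [WithLp.prod_inner_apply, WithLp.prod_inner_apply, add_comm]
  exact congr($(h.symm ⟨x.fst, hx.1⟩ ⟨y.snd, hy.2⟩) + $(h ⟨x.snd, hx.2⟩ ⟨y.fst, hy.1⟩))

theorem offDiag_solves {c : ℝ} {x y : WithLp 2 (H₀ × H₁)} (hT : y.fst ∈ T.domain)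
    (hS : y.snd ∈ S.domain) (hST : T ⟨y.fst, hT⟩ ∈ S.domain) (hTS : S ⟨y.snd, hS⟩ ∈ T.domain)
    (h₀ : y.fst + (c : ℂ) • y.fst + S ⟨_, hST⟩ = x.fst)
    (h₁ : y.snd + (c : ℂ) • y.snd + T ⟨_, hTS⟩ = x.snd) : SolvesShifted (offDiag S T) c x y :=
  ⟨⟨hT, hS⟩, ⟨hTS, hST⟩, WithLp.ofLp_injective 2 (Prod.ext h₀ h₁)⟩

variable [CompleteSpace H₀] [CompleteSpace H₁]

/-- The adjoint relation of the matrix is tested on vectors with one zero component. This yields the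
graded form of the Dirac operator without computing the adjoint of `D_A ⊗ 1 - i ⊗ M_l` directly. -/
theorem dense_and_eq_adjoint_of_isSelfAdjoint_offDiag (h : IsSelfAdjoint (offDiag S T)) :
    Dense (S.domain : Set H₁) ∧ T = S† := by
  have hd := h.dense_domain
  have hS : Dense (S.domain : Set H₁) := by
    refine Dense.mono ?_ ((Function.Surjective.denseRange (f := fun x : WithLp 2 (H₀ × H₁) => x.snd)
      fun y => ⟨WithLp.toLp 2 (0, y), rfl⟩).dense_image (WithLp.sndL 2 ℂ H₀ H₁).continuous hd)
    rintro _ ⟨x, hx, rfl⟩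
    exact hx.2
  refine ⟨hS, ?_⟩
  rw [LinearPMap.isSelfAdjoint_def] at h
  have hfa := LinearPMap.adjoint_isFormalAdjoint hd
  rw [h] at hfa
  have hTS : S.IsFormalAdjoint T := fun x y => by
    have := hfa ⟨WithLp.toLp 2 (0, (x : H₁)), zero_mem _, x.2⟩
      ⟨WithLp.toLp 2 ((y : H₀), 0), y.2, zero_mem _⟩
    rw [WithLp.prod_inner_apply, WithLp.prod_inner_apply] at this
    have h1 : T ⟨0, zero_mem _⟩ = 0 := T.map_zero
    have h2 : S ⟨0, zero_mem _⟩ = 0 := S.map_zero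
    simpa [offDiag, h1, h2] using this
  refine le_antisymm (hTS.le_adjoint hS) ?_
  have hSa := LinearPMap.adjoint_isFormalAdjoint hS
  have hdom : S†.domain ≤ T.domain := fun y hy => by
    suffices hmem : WithLp.toLp 2 (y, (0 : H₁)) ∈ (offDiag S T)†.domain by
      rw [h] at hmem
      exact hmem.1
    refine LinearPMap.mem_adjoint_domain_of_exists _ ⟨WithLp.toLp 2 (0, S† ⟨y, hy⟩), fun x => ?_⟩
    rw [WithLp.prod_inner_apply, WithLp.prod_inner_apply]
    change _ = ⟪y, S ⟨_, x.2.2⟩⟫_ℂ + ⟪(0 : H₁), T ⟨_, x.2.1⟩⟫_ℂ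
    simpa using hSa ⟨y, hy⟩ ⟨_, x.2.2⟩
  exact ⟨hdom, fun _ _ hxy => ((hTS.le_adjoint hS).2 hxy.symm).symm⟩

end OffDiag

/-! ### The components of the Dirac operator -/

section DiracPart

open scoped ComplexConjugate

variable {Γ : Type*} {H : Type*} [NormedAddCommGroup H] [InnerProductSpace ℂ H]

/-- The operator `D ⊗ 1 + ε ⊗ M_l`. -/
def diracPart (D : H →ₗ.[ℂ] H) (l : Γ → ℤ) (ε : ℂ) : EllTwo Γ H →ₗ.[ℂ] EllTwo Γ H :=
  tensorOne D + ε • mulOp H l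

variable {D : H →ₗ.[ℂ] H} {l : Γ → ℤ} {ε : ℂ}

theorem crossedDirac_eq (D : H →ₗ.[ℂ] H) (l : Γ → ℤ) :
    crossedDirac D l = offDiag (diracPart D l (-Complex.I)) (diracPart D l Complex.I) := by
  have : tensorOne D - Complex.I • mulOp H l = diracPart D l (-Complex.I) := by
    refine LinearPMap.ext rfl fun x y hxy => ?_
    change _ - Complex.I • mulOp H l ⟨x, _⟩ = _ + -Complex.I • mulOp H l ⟨x, _⟩
    rw [neg_smul, ← sub_eq_add_neg]
    rfl
  rw [crossedDirac, this]
  rfl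

theorem mulOp_apply (x : (mulOp H l).domain) (g : Γ) :
    mulOp H l x g = (l g : ℂ) • (x : EllTwo Γ H) g := rfl

theorem diracPart_apply (x : (diracPart D l ε).domain) (g : Γ) :
    diracPart D l ε x g =
      D ⟨(x : EllTwo Γ H) g, x.2.1.1 g⟩ + ε • (l g : ℂ) • (x : EllTwo Γ H) g := rfl

/-- The domain of the sum is the intersection of the two domains, so `D x_g` and `l(g) x_g` must be
square summable separately. -/
theorem mem_diracPart_domain {x y : EllTwo Γ H} {C : ℝ} (h : ∀ g, x g ∈ D.domain)
    (h₁ : ∀ g, ‖D ⟨x g, h g⟩‖ ≤ C * ‖y g‖) (h₂ : ∀ g, |(l g : ℝ)| * ‖x g‖ ≤ C * ‖y g‖) :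
    x ∈ (diracPart D l ε).domain := by
  have hC : ∀ g, C * ‖y g‖ ≤ ‖((C : ℂ) • y : EllTwo Γ H) g‖ := fun g => by
    rw [lp.coeFn_smul, Pi.smul_apply, norm_smul, Complex.norm_real]
    exact mul_le_mul_of_nonneg_right (le_abs_self C) (norm_nonneg _)
  refine ⟨⟨h, (lp.memℓp ((C : ℂ) • y : EllTwo Γ H)).mono' fun g => (h₁ g).trans (hC g)⟩,
    ⟨fun g => trivial, (lp.memℓp ((C : ℂ) • y : EllTwo Γ H)).mono' fun g => ?_⟩⟩
  refine le_trans (le_of_eq ?_) ((h₂ g).trans (hC g))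
  change ‖(l g : ℂ) • x g‖ = _
  rw [norm_smul, Complex.norm_intCast]

theorem diracPart_isFormalAdjoint (hD : D.IsFormalAdjoint D) :
    (diracPart D l ε).IsFormalAdjoint (diracPart D l (conj ε)) := by
  intro x y
  rw [lp.inner_eq_tsum, lp.inner_eq_tsum]
  refine tsum_congr fun g => ?_
  rw [diracPart_apply, diracPart_apply, inner_add_left, inner_add_right]
  have := hD ⟨_, x.2.1.1 g⟩ ⟨_, y.2.1.1 g⟩
  rw [this]
  simp only [inner_smul_left, inner_smul_right, map_intCast]

variable [CompleteSpace H] {R : H →L[ℂ] H}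

open scoped NNReal

/-- The direct sum over `g` of the operators `(1 + l(g)² + D²)⁻¹`, where `R = (1 + D²)⁻¹`. -/
def sumShiftInv (l : Γ → ℤ) (R : H →L[ℂ] H)
    (hle : ∀ c : ℝ≥0, ‖shiftInv R c‖ ≤ (1 + c : ℝ)⁻¹) : EllTwo Γ H →L[ℂ] EllTwo Γ H :=
  boundedSum (fun g => shiftInv R ((l g).natAbs ^ 2)) 1 fun g =>
    (hle _).trans (inv_le_one_of_one_le₀ (by simp; positivity))

theorem coe_natAbs_sq (n : ℤ) : (((n.natAbs : ℝ≥0) ^ 2 : ℝ≥0) : ℝ) = (n : ℝ) ^ 2 := by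
  simp [Nat.cast_natAbs]

theorem solves_coord (hD : D.IsFormalAdjoint D) (hR : IsInvOneAddSq D R) (l : Γ → ℤ)
    (x : EllTwo Γ H) (g : Γ) : SolvesShifted D ((l g : ℝ) ^ 2) (x g)
      (sumShiftInv l R (hR.norm_shiftInv_le hD) x g) := by
  rw [← coe_natAbs_sq]
  exact hR.shiftInv_solves hD _ _

theorem sumShiftInv_mem_domain (hD : D.IsFormalAdjoint D) (hR : IsInvOneAddSq D R)
    (x : EllTwo Γ H) :
    sumShiftInv l R (hR.norm_shiftInv_le hD) x ∈ (diracPart D l ε).domain := by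
  have hs := solves_coord hD hR l x
  have h0 : ∀ g, 0 ≤ (l g : ℝ) ^ 2 := fun g => sq_nonneg _
  refine mem_diracPart_domain (C := 1) (y := x) (fun g => (hs g).1) (fun g => ?_) fun g => ?_
  · rw [one_mul]
    refine le_of_sq_le_sq ?_ (norm_nonneg _)
    nlinarith [(hs g).norm_sq_map_le hD (h0 g), mul_nonneg (h0 g) (sq_nonneg ‖D ⟨_, (hs g).1⟩‖)]
  · rw [one_mul]
    refine le_trans ?_ ((hs g).norm_le hD)
    gcongr
    nlinarith [sq_nonneg (|(l g : ℝ)| - 1), sq_abs (l g : ℝ)]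

theorem diracPart_sumShiftInv_mem_domain (hD : D.IsFormalAdjoint D) (hR : IsInvOneAddSq D R)
    (hε : ‖ε‖ = 1) {ε' : ℂ} (x : EllTwo Γ H) :
    diracPart D l ε ⟨_, sumShiftInv_mem_domain hD hR x⟩ ∈ (diracPart D l ε').domain := by
  have hs := solves_coord hD hR l x
  have h0 : ∀ g, 0 ≤ (l g : ℝ) ^ 2 := fun g => sq_nonneg _
  have hmem : ∀ g, ε • (l g : ℂ) • sumShiftInv l R (hR.norm_shiftInv_le hD) x g ∈ D.domain :=
    fun g => D.domain.smul_mem _ (D.domain.smul_mem _ (hs g).1)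
  have h1 : ∀ g, |(l g : ℝ)| * ‖D ⟨_, (hs g).1⟩‖ ≤ ‖x g‖ := fun g => by
    refine le_of_sq_le_sq ?_ (norm_nonneg _)
    rw [mul_pow, sq_abs]
    nlinarith [(hs g).norm_sq_map_le hD (h0 g), sq_nonneg ‖D ⟨_, (hs g).1⟩‖]
  have h2 : ∀ g, |(l g : ℝ)| * (|(l g : ℝ)| * ‖sumShiftInv l R (hR.norm_shiftInv_le hD) x g‖)
      ≤ ‖x g‖ := fun g => by
    rw [← mul_assoc, abs_mul_abs_self]
    nlinarith [(hs g).norm_le hD, norm_nonneg (sumShiftInv l R (hR.norm_shiftInv_le hD) x g)]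
  have hn : ∀ (z : H) (g : Γ), ‖ε • (l g : ℂ) • z‖ = |(l g : ℝ)| * ‖z‖ := fun z g => by
    rw [norm_smul, norm_smul, hε, one_mul, Complex.norm_intCast]
  -- With `y` the solution at `g`, `‖D² y‖` costs `2 ‖x_g‖`, while `|l| ‖D y‖` and `l² ‖y‖` cost
  -- `‖x_g‖` each. Applying `D` thus needs `3`, applying `l` only `2`.
  refine mem_diracPart_domain (C := 3) (y := x) (fun g => add_mem (hs g).2.1 (hmem g))
    (fun g => ?_) fun g => ?_
  · have e : D ⟨_, add_mem (hs g).2.1 (hmem g)⟩ =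
        D ⟨_, (hs g).2.1⟩ + ε • (l g : ℂ) • D ⟨_, (hs g).1⟩ := by
      rw [← D.map_smul, ← D.map_smul]
      exact D.map_add ⟨_, (hs g).2.1⟩ ⟨_, hmem g⟩
    refine (congrArg norm e).le.trans ((norm_add_le _ _).trans ?_)
    rw [hn]
    linarith [h1 g, (hs g).norm_map_map_le hD (h0 g)]
  · rw [diracPart_apply]
    refine (mul_le_mul_of_nonneg_left (norm_add_le _ _) (abs_nonneg _)).trans ?_
    rw [mul_add, hn]
    linarith [h1 g, h2 g, norm_nonneg (x g)]

/-- In `(D + ε' l)(D + ε l)` the mixed terms cancel because `ε' = -ε`, and `ε ε' = 1` leaves `D² +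
l²`, which the shifted equation evaluates. -/
theorem diracPart_diracPart (hD : D.IsFormalAdjoint D) (hR : IsInvOneAddSq D R)
    (hε : ‖ε‖ = 1) {ε' : ℂ} (hsum : ε' = -ε) (hprod : ε * ε' = 1) (x : EllTwo Γ H) :
    diracPart D l ε' ⟨_, diracPart_sumShiftInv_mem_domain hD hR hε x⟩ =
      x - sumShiftInv l R (hR.norm_shiftInv_le hD) x := by
  have hs := solves_coord hD hR l x
  have hmem : ∀ g, ε • (l g : ℂ) • sumShiftInv l R (hR.norm_shiftInv_le hD) x g ∈ D.domain :=
    fun g => D.domain.smul_mem _ (D.domain.smul_mem _ (hs g).1)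
  refine lp.ext (funext fun g => ?_)
  have e : D ⟨_, add_mem (hs g).2.1 (hmem g)⟩ =
      D ⟨_, (hs g).2.1⟩ + ε • (l g : ℂ) • D ⟨_, (hs g).1⟩ := by
    rw [← D.map_smul, ← D.map_smul]
    exact D.map_add ⟨_, (hs g).2.1⟩ ⟨_, hmem g⟩
  have h := (hs g).2.2
  have h2 : ε' • (l g : ℂ) • ε • (l g : ℂ) • sumShiftInv l R (hR.norm_shiftInv_le hD) x g =
      (((l g : ℝ) ^ 2 : ℝ) : ℂ) • sumShiftInv l R (hR.norm_shiftInv_le hD) x g := by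
    simp only [smul_smul]
    congr 1
    push_cast
    linear_combination (l g : ℂ) ^ 2 * hprod
  have h3 : D ⟨_, add_mem (hs g).2.1 (hmem g)⟩ + ε' • (l g : ℂ) • (D ⟨_, (hs g).1⟩ +
      ε • (l g : ℂ) • sumShiftInv l R (hR.norm_shiftInv_le hD) x g) =
        x g - sumShiftInv l R (hR.norm_shiftInv_le hD) x g := by
    rw [e, smul_add, smul_add, h2, eq_sub_iff_add_eq]
    conv_rhs => rw [← h]
    rw [hsum, neg_smul]
    abel
  exact h3

omit [CompleteSpace H] in
theorem crossedDirac_isFormalAdjoint (hD : D.IsFormalAdjoint D) :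
    (crossedDirac D l).IsFormalAdjoint (crossedDirac D l) := by
  rw [crossedDirac_eq]
  have h := diracPart_isFormalAdjoint (l := l) (ε := -Complex.I) hD
  simp only [map_neg, Complex.conj_I, neg_neg] at h
  exact offDiag_isFormalAdjoint h

theorem crossedDirac_solves (hD : D.IsFormalAdjoint D) (hR : IsInvOneAddSq D R)
    (x : WithLp 2 (EllTwo Γ H × EllTwo Γ H)) :
    SolvesShifted (crossedDirac D l) 0 x
      (diagOp (sumShiftInv l R (hR.norm_shiftInv_le hD))
        (sumShiftInv l R (hR.norm_shiftInv_le hD)) x) := by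
  rw [crossedDirac_eq]
  have hI : ‖-Complex.I‖ = 1 := by simp
  refine offDiag_solves (sumShiftInv_mem_domain hD hR x.fst) (sumShiftInv_mem_domain hD hR x.snd)
    (diracPart_sumShiftInv_mem_domain hD hR Complex.norm_I x.fst)
    (diracPart_sumShiftInv_mem_domain hD hR hI x.snd) ?_ ?_
  · refine (congrArg (_ + ·)
      (diracPart_diracPart hD hR Complex.norm_I rfl (by simp) x.fst)).trans ?_
    simp [diagOp_apply]
  · refine (congrArg (_ + ·) (diracPart_diracPart hD hR hI (by simp) (by simp) x.snd)).trans ?_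
    simp [diagOp_apply]

theorem crossedDirac_isInvOneAddSq (hD : D.IsFormalAdjoint D) (hR : IsInvOneAddSq D R) :
    IsInvOneAddSq (crossedDirac D l) (diagOp (sumShiftInv l R (hR.norm_shiftInv_le hD))
        (sumShiftInv l R (hR.norm_shiftInv_le hD))) :=
  isInvOneAddSq_of_solves (crossedDirac_isFormalAdjoint hD) (crossedDirac_solves hD hR)

theorem crossedDirac_isSelfAdjoint (hD : D.IsFormalAdjoint D) (hR : IsInvOneAddSq D R) :
    IsSelfAdjoint (crossedDirac D l) :=
  isSelfAdjoint_of_solves (crossedDirac_isFormalAdjoint hD) fun x =>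
    ⟨_, crossedDirac_solves hD hR x⟩

end DiracPart

/-! ### Compactness of direct sums -/

section Compact

open Filter Topology

variable {Γ : Type*} {H : Type*} [NormedAddCommGroup H] [InnerProductSpace ℂ H]

/-- The isometry `ξ ↦ ξ ⊗ δ_g`. -/
def single (g : Γ) : H →L[ℂ] EllTwo Γ H :=
  open Classical in lp.singleContinuousLinearMap ℂ (fun _ : Γ => H) 2 g

theorem single_apply_self (g : Γ) (ξ : H) : single g ξ g = ξ := by
  classical
  exact lp.single_apply_self _ _ _

theorem single_apply_of_ne {g k : Γ} (h : k ≠ g) (ξ : H) : single g ξ k = 0 := by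
  classical
  exact lp.single_apply_ne _ _ _ h

theorem inner_single_left (g : Γ) (ξ : H) (x : EllTwo Γ H) : ⟪single g ξ, x⟫_ℂ = ⟪ξ, x g⟫_ℂ := by
  classical
  exact lp.inner_single_left _ _ _

theorem boundedSum_comp_single (T : Γ → (H →L[ℂ] H)) (C : ℝ) (hC : ∀ g, ‖T g‖ ≤ C) (g : Γ) :
    boundedSum T C hC ∘L single g = single g ∘L T g := by
  ext ξ k
  change T k (single g ξ k) = single g (T g ξ) k
  by_cases h : k = g
  · subst h
    rw [single_apply_self, single_apply_self]
  · rw [single_apply_of_ne h, single_apply_of_ne h, map_zero]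

theorem norm_boundedSum_le (T : Γ → (H →L[ℂ] H)) (C : ℝ) (hC : ∀ g, ‖T g‖ ≤ C) :
    ‖boundedSum T C hC‖ ≤ |C| :=
  by
  rw [boundedSum]
  exact LinearMap.mkContinuous_norm_le _ (abs_nonneg _) _

/-- Finite truncations are compact, and the norm of the remainder is bounded by any common bound on
the omitted blocks, so they converge in norm. -/
theorem isCompactOperator_boundedSum [CompleteSpace H] {T : Γ → (H →L[ℂ] H)} {C : ℝ}
    (hC : ∀ g, ‖T g‖ ≤ C)
    (hT : ∀ g, IsCompactOperator (T g)) (h0 : Tendsto (fun g => ‖T g‖) cofinite (𝓝 0)) :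
    IsCompactOperator (boundedSum T C hC) := by
  classical
  let F : Finset Γ → EllTwo Γ H →L[ℂ] EllTwo Γ H := fun s =>
    ∑ g ∈ s, single g ∘L T g ∘L lp.evalCLM ℂ (fun _ : Γ => H) 2 g
  have hF : ∀ s, IsCompactOperator (F s) := fun s => by
    refine Finset.sum_induction _ (fun S : EllTwo Γ H →L[ℂ] EllTwo Γ H => IsCompactOperator S)
      (fun S S' h h' => h.add h') isCompactOperator_zero fun g _ => ?_
    exact ((hT g).comp_clm _).clm_comp (single g)
  have hFx : ∀ s x g, F s x g = if g ∈ s then T g (x g) else 0 := fun s x g => by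
    simp only [F, sum_apply, lp.coeFn_sum, Finset.sum_apply]
    split_ifs with hg
    · rw [Finset.sum_eq_single g (fun k _ hk => single_apply_of_ne hk.symm _)
        fun h => absurd hg h]
      exact single_apply_self _ _
    · refine Finset.sum_eq_zero fun k hk => single_apply_of_ne ?_ _
      rintro rfl
      exact hg hk
  refine isCompactOperator_of_tendsto (l := atTop) (F := F) ?_ (Eventually.of_forall hF)
  rw [Metric.tendsto_atTop]
  intro ε hε
  have hev := h0.eventually (gt_mem_nhds (half_pos hε))
  rw [eventually_cofinite] at hev
  refine ⟨hev.toFinset, fun s hs => ?_⟩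
  have hle : ∀ g, ‖(if g ∈ s then 0 else T g)‖ ≤ ε / 2 := fun g => by
    split_ifs with hg
    · simpa using (half_pos hε).le
    · by_contra hlt
      exact hg (hs (hev.mem_toFinset.2 fun h => hlt h.le))
  have heq : boundedSum T C hC - F s =
      boundedSum (fun g => if g ∈ s then 0 else T g) (ε / 2) hle := by
    ext x g
    change T g (x g) - F s x g = (if g ∈ s then 0 else T g) (x g)
    rw [hFx]
    split_ifs <;> simp
  rw [dist_comm, dist_eq_norm, heq]
  refine (norm_boundedSum_le _ _ _).trans_lt ?_
  rw [abs_of_pos (half_pos hε)]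
  exact half_lt_self hε

end Compact

/-! ### The direct sum of two copies -/

section TwoCopies

variable {H₀ : Type*} [NormedAddCommGroup H₀] [InnerProductSpace ℂ H₀]
  {H₁ : Type*} [NormedAddCommGroup H₁] [InnerProductSpace ℂ H₁]

variable (H₀ H₁) in
/-- The inclusion of the first summand of `H₀ ⊕ H₁`. -/
def inlL : H₀ →L[ℂ] WithLp 2 (H₀ × H₁) :=
  (WithLp.prodContinuousLinearEquiv 2 ℂ H₀ H₁).symm.toContinuousLinearMap ∘L
    ContinuousLinearMap.inl ℂ H₀ H₁

variable (H₀ H₁) in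
/-- The inclusion of the second summand of `H₀ ⊕ H₁`. -/
def inrL : H₁ →L[ℂ] WithLp 2 (H₀ × H₁) :=
  (WithLp.prodContinuousLinearEquiv 2 ℂ H₀ H₁).symm.toContinuousLinearMap ∘L
    ContinuousLinearMap.inr ℂ H₀ H₁

theorem inner_inlL_left (ξ : H₀) (x : WithLp 2 (H₀ × H₁)) :
    ⟪inlL H₀ H₁ ξ, x⟫_ℂ = ⟪ξ, x.fst⟫_ℂ := by
  rw [WithLp.prod_inner_apply]
  simp [inlL]

theorem inner_inrL_left (ξ : H₁) (x : WithLp 2 (H₀ × H₁)) :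
    ⟪inrL H₀ H₁ ξ, x⟫_ℂ = ⟪ξ, x.snd⟫_ℂ := by
  rw [WithLp.prod_inner_apply]
  simp [inrL]

theorem diagOp_comp_inlL (S : H₀ →L[ℂ] H₀) (T : H₁ →L[ℂ] H₁) :
    diagOp S T ∘L inlL H₀ H₁ = inlL H₀ H₁ ∘L S :=
  ContinuousLinearMap.ext fun _ => WithLp.ofLp_injective 2 (Prod.ext rfl T.map_zero)

theorem diagOp_comp_inrL (S : H₀ →L[ℂ] H₀) (T : H₁ →L[ℂ] H₁) :
    diagOp S T ∘L inrL H₀ H₁ = inrL H₀ H₁ ∘L T :=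
  ContinuousLinearMap.ext fun _ => WithLp.ofLp_injective 2 (Prod.ext S.map_zero rfl)

theorem isCompactOperator_diagOp {S : H₀ →L[ℂ] H₀} {T : H₁ →L[ℂ] H₁} (hS : IsCompactOperator S)
    (hT : IsCompactOperator T) : IsCompactOperator (diagOp S T) := by
  have h : diagOp S T = inlL H₀ H₁ ∘L S ∘L WithLp.fstL 2 ℂ H₀ H₁ +
      inrL H₀ H₁ ∘L T ∘L WithLp.sndL 2 ℂ H₀ H₁ :=
    ContinuousLinearMap.ext fun _ => WithLp.ofLp_injective 2
      (Prod.ext (add_zero _).symm (zero_add _).symm)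
  rw [h]
  exact ((hS.comp_clm _).clm_comp (inlL H₀ H₁)).add ((hT.comp_clm _).clm_comp (inrL H₀ H₁))

end TwoCopies

/-! ### Parseval frames of direct sums -/

section Parseval

variable {H₀ : Type*} [NormedAddCommGroup H₀] [InnerProductSpace ℂ H₀]
  {H₁ : Type*} [NormedAddCommGroup H₁] [InnerProductSpace ℂ H₁]

theorem IsParseval.sumElim {κ₀ κ₁ : Type*} {v : κ₀ → H₀} {w : κ₁ → H₁} (hv : IsParseval v)
    (hw : IsParseval w) :
    IsParseval (Sum.elim (fun j => inlL H₀ H₁ (v j)) (fun j => inrL H₀ H₁ (w j))) := fun x => by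
  rw [Summable.tsum_sum ENNReal.summable ENNReal.summable]
  simp only [Sum.elim_inl, Sum.elim_inr, inner_inlL_left, inner_inrL_left]
  rw [hv, hw]
  simp only [← ofReal_norm, ← ENNReal.ofReal_pow (norm_nonneg _)]
  rw [← ENNReal.ofReal_add (by positivity) (by positivity), WithLp.prod_norm_sq_eq_of_L2]

theorem IsParseval.single {Γ κ : Type*} {v : κ → H₀} (hv : IsParseval v) :
    IsParseval (fun j : Γ × κ => single j.1 (v j.2)) := fun x => by
  simp only [inner_single_left]
  rw [ENNReal.tsum_prod (f := fun g i => ‖⟪v i, x g⟫_ℂ‖ₑ ^ 2)]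
  simp only [hv _]
  have h := lp.hasSum_norm (p := 2) (by simp) x
  simp only [ENNReal.toReal_ofNat, Real.rpow_two] at h
  simp only [← ofReal_norm, ← ENNReal.ofReal_pow (norm_nonneg _)]
  rw [← ENNReal.ofReal_tsum_of_nonneg (fun g => by positivity) h.summable, h.tsum_eq]

end Parseval

/-! ### Powers and eigenvectors -/

section Eigenvector

open scoped NNReal

variable {H : Type*} [NormedAddCommGroup H] [InnerProductSpace ℂ H] [CompleteSpace H]

omit [CompleteSpace H] in
theorem algebraMap_nnreal_apply (r : ℝ≥0) (z : H) :
    algebraMap ℝ≥0 (H →L[ℂ] H) r z = (r : ℂ) • z := by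
  rw [Algebra.algebraMap_eq_smul_one]
  rfl

omit [CompleteSpace H] in
theorem algebraMap_nnreal_nonneg (r : ℝ≥0) : 0 ≤ algebraMap ℝ≥0 (H →L[ℂ] H) r := by
  rw [ContinuousLinearMap.nonneg_iff_isPositive, ContinuousLinearMap.isPositive_iff_complex]
  intro x
  have h0 : 0 ≤ (r : ℝ) * ‖x‖ ^ 2 := by positivity
  have h1 : ⟪algebraMap ℝ≥0 (H →L[ℂ] H) r x, x⟫_ℂ = (((r : ℝ) * ‖x‖ ^ 2 : ℝ) : ℂ) := by
    rw [algebraMap_nnreal_apply, inner_smul_left, inner_self_eq_ofReal, Complex.ofReal_mul]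
    exact congrArg (· * _) (Complex.conj_ofReal _)
  rw [h1]
  exact ⟨rfl, h0⟩

/-- An eigenvector equation says that `z ↦ z • v` intertwines multiplication by `r` on `ℂ` with `R`,
and powers respect intertwining. -/
theorem rpow_apply_of_eigenvector {R : H →L[ℂ] H} (hR : 0 ≤ R) {v : H} {r : ℝ≥0}
    (h : R v = (r : ℂ) • v) {s : ℝ} (hs : 0 ≤ s) : (R ^ s) v = ((r ^ s : ℝ≥0) : ℂ) • v := by
  have hJ : R ∘L ContinuousLinearMap.toSpanSingleton ℂ v =
      ContinuousLinearMap.toSpanSingleton ℂ v ∘L algebraMap ℝ≥0 (ℂ →L[ℂ] ℂ) r := by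
    refine ContinuousLinearMap.ext fun z => ?_
    simp only [ContinuousLinearMap.comp_apply, ContinuousLinearMap.toSpanSingleton_apply,
      algebraMap_nnreal_apply, map_smul, h, smul_eq_mul, smul_smul, mul_comm]
  have h1 := congr($(rpow_comp_of_comp_eq hR (algebraMap_nnreal_nonneg r) hJ hs) 1)
  rw [CFC.rpow_algebraMap] at h1
  simpa only [ContinuousLinearMap.comp_apply, ContinuousLinearMap.toSpanSingleton_apply,
    algebraMap_nnreal_apply, smul_eq_mul, mul_one, one_smul] using h1

theorem re_inner_rpow_of_eigenvector {R : H →L[ℂ] H} (hR : 0 ≤ R) {v : H} (hv : ‖v‖ = 1) {r : ℝ≥0}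
    (h : R v = (r : ℂ) • v) {s : ℝ} (hs : 0 ≤ s) :
    (⟪v, (R ^ s) v⟫_ℂ).re = ((r ^ s : ℝ≥0) : ℝ) := by
  rw [rpow_apply_of_eigenvector hR h hs, inner_smul_right, inner_self_eq_ofReal, hv, one_pow,
    Complex.ofReal_one, mul_one]
  exact Complex.ofReal_re _

end Eigenvector

/-! ### The multiplication operator -/

section MulOp

variable {Γ : Type*} {H : Type*} [NormedAddCommGroup H] [InnerProductSpace ℂ H] {l : Γ → ℤ}

theorem mulOp_isFormalAdjoint : (mulOp H l).IsFormalAdjoint (mulOp H l) := by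
  intro x y
  rw [lp.inner_eq_tsum, lp.inner_eq_tsum]
  refine tsum_congr fun g => ?_
  rw [mulOp_apply, mulOp_apply]
  simp only [inner_smul_left, inner_smul_right, map_intCast]

theorem mulOp_single (g : Γ) (ξ : H) :
    ∃ h : single g ξ ∈ (mulOp H l).domain,
      mulOp H l ⟨single g ξ, h⟩ = single g ((l g : ℂ) • ξ) := by
  have h : ∀ k, (l k : ℂ) • single g ξ k = single g ((l g : ℂ) • ξ) k := fun k => by
    by_cases hk : k = g
    · subst hk
      rw [single_apply_self, single_apply_self]
    · rw [single_apply_of_ne hk, single_apply_of_ne hk, smul_zero]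
  refine ⟨⟨fun k => trivial, ?_⟩, lp.ext (funext h)⟩
  convert lp.memℓp (single g ((l g : ℂ) • ξ)) using 1
  exact funext h

open scoped NNReal

theorem inv_apply_single {R : EllTwo Γ H →L[ℂ] EllTwo Γ H} (hR : IsInvOneAddSq (mulOp H l) R)
    (g : Γ) (ξ : H) :
    R (single g ξ) = (((1 + ((l g).natAbs : ℝ≥0) ^ 2)⁻¹ : ℝ≥0) : ℂ) • single g ξ := by
  set c : ℝ≥0 := ((l g).natAbs : ℝ≥0) ^ 2 with hc
  rw [← map_smul, hR]
  obtain ⟨h₁, e₁⟩ := mulOp_single (l := l) g ((((1 + c)⁻¹ : ℝ≥0) : ℂ) • ξ)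
  obtain ⟨h₂, e₂⟩ := mulOp_single (l := l) g ((l g : ℂ) • (((1 + c)⁻¹ : ℝ≥0) : ℂ) • ξ)
  refine ⟨h₁, e₁ ▸ h₂, ?_⟩
  have e₃ : mulOp H l ⟨mulOp H l ⟨_, h₁⟩, e₁ ▸ h₂⟩ = mulOp H l ⟨_, h₂⟩ :=
    congrArg _ (Subtype.ext e₁)
  rw [e₃, e₂, ← map_add]
  congr 1
  have hne : ((1 + c : ℝ≥0) : ℂ) ≠ 0 := by
    have : (1 + c : ℝ≥0) ≠ 0 := by positivity
    exact_mod_cast this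
  have hcl : ((1 + c : ℝ≥0) : ℂ) = 1 + (l g : ℂ) * (l g : ℂ) := by
    have h1 : (((1 + c : ℝ≥0) : ℝ) : ℂ) = ((1 + (l g : ℝ) ^ 2 : ℝ) : ℂ) := by
      rw [NNReal.coe_add, hc, coe_natAbs_sq, NNReal.coe_one]
    refine h1.trans ?_
    push_cast
    ring
  have hinv : (((1 + c)⁻¹ : ℝ≥0) : ℂ) = ((1 + c : ℝ≥0) : ℂ)⁻¹ := by push_cast; rfl
  simp only [smul_smul]
  rw [← add_smul, hinv]
  have h4 : ((1 + c : ℝ≥0) : ℂ)⁻¹ + (l g : ℂ) * ((l g : ℂ) * ((1 + c : ℝ≥0) : ℂ)⁻¹) = 1 := by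
    rw [← mul_assoc, ← one_add_mul, ← hcl, mul_inv_cancel₀ hne]
  rw [h4, one_smul]

theorem norm_single (g : Γ) (ξ : H) : ‖single g ξ‖ = ‖ξ‖ := by
  classical
  exact lp.norm_single two_pos _ _

theorem summable_of_isPSummable_mulOp {q : ℝ} (hq : 0 < q) (h : IsPSummable (mulOp ℂ l) q) :
    Summable fun g => (((1 + ((l g).natAbs : ℝ≥0) ^ 2) ^ (-(q / 2)) : ℝ≥0) : ℝ) := by
  obtain ⟨R, hR, htr⟩ := h
  have h := htr Γ (HilbertBasis.ofRepr (LinearIsometryEquiv.refl ℂ _))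
  refine h.congr fun g => ?_
  have he : (HilbertBasis.ofRepr (LinearIsometryEquiv.refl ℂ (EllTwo Γ ℂ)) : HilbertBasis Γ ℂ _) g
      = single g 1 := by
    classical
    rw [← HilbertBasis.repr_symm_single]
    refine lp.ext (funext fun k => ?_)
    by_cases hk : k = g
    · subst hk
      rw [single_apply_self]
      exact lp.single_apply_self _ _ _
    · rw [single_apply_of_ne hk]
      exact lp.single_apply_ne _ _ _ hk
  rw [he, CFC.abs_of_nonneg _ CFC.rpow_nonneg, NNReal.rpow_neg, ← NNReal.inv_rpow]
  exact re_inner_rpow_of_eigenvector (hR.nonneg mulOp_isFormalAdjoint)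
    ((norm_single _ _).trans norm_one) (inv_apply_single hR g 1) (half_pos hq).le

end MulOp

/-! ### Compact resolvent and summability of the Dirac operator -/

section PSummable

variable {Γ : Type*} {H : Type*} [NormedAddCommGroup H] [InnerProductSpace ℂ H] [CompleteSpace H]
  {D : H →ₗ.[ℂ] H} {l : Γ → ℤ} {R : H →L[ℂ] H}

open Filter Topology
open scoped NNReal

theorem tendsto_inv_one_add_sq (hl : ∀ n : ℤ, {g | l g = n}.Finite) :
    Tendsto (fun g => (1 + (l g : ℝ) ^ 2)⁻¹) cofinite (𝓝 0) := by
  have h1 : Tendsto l cofinite cofinite := Tendsto.cofinite_of_finite_preimage_singleton hl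
  have h2 : Tendsto (fun n : ℤ => (n : ℝ) ^ 2) cofinite atTop := by
    have h3 : Tendsto (fun n : ℤ => |(n : ℝ)|) cofinite atTop := by
      rw [Int.cofinite_eq, tendsto_sup]
      exact ⟨tendsto_abs_atBot_atTop.comp (tendsto_intCast_atBot_iff.2 tendsto_id),
        tendsto_abs_atTop_atTop.comp tendsto_intCast_atTop_atTop⟩
    refine ((tendsto_pow_atTop two_ne_zero).comp h3).congr fun n => ?_
    exact sq_abs _
  exact (tendsto_atTop_add_const_left _ _ (h2.comp h1)).inv_tendsto_atTop

theorem isCompactOperator_sumShiftInv (hl : ∀ n : ℤ, {g | l g = n}.Finite) (hR0 : 0 ≤ R)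
    (hR : IsCompactOperator R) (hle : ∀ c : ℝ≥0, ‖shiftInv R c‖ ≤ (1 + c : ℝ)⁻¹) :
    IsCompactOperator (sumShiftInv l R hle) := by
  refine isCompactOperator_boundedSum _ (fun g => isCompactOperator_shiftInv hR0 hR _) ?_
  refine squeeze_zero (fun g => norm_nonneg _) (fun g => (hle _).trans_eq ?_)
    (tendsto_inv_one_add_sq hl)
  rw [coe_natAbs_sq]

theorem crossedDirac_hasCompactResolvent (hD : D.IsFormalAdjoint D) (h : HasCompactResolvent D)
    (hl : ∀ n : ℤ, {g | l g = n}.Finite) : HasCompactResolvent (crossedDirac D l) := by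
  obtain ⟨R, hR, hc⟩ := h
  have hR0 := hR.nonneg hD
  have hbig := crossedDirac_isInvOneAddSq (l := l) hD hR
  have hK := isCompactOperator_sumShiftInv hl hR0 (isCompactOperator_of_rpow_half hR0 hc)
    (hR.norm_shiftInv_le hD)
  exact ⟨_, hbig, isCompactOperator_rpow_half (hbig.nonneg (crossedDirac_isFormalAdjoint hD))
    (isCompactOperator_diagOp hK hK)⟩

omit [CompleteSpace H] in
theorem re_inner_le_of_le {S T : H →L[ℂ] H} (h : S ≤ T) (x : H) :
    (⟪x, S x⟫_ℂ).re ≤ (⟪x, T x⟫_ℂ).re := by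
  have := (ContinuousLinearMap.le_def _ _).1 h |>.re_inner_nonneg_right x
  rw [sub_apply, inner_sub_right, map_sub] at this
  exact sub_nonneg.1 this

theorem re_inner_rpow_nonneg (R : H →L[ℂ] H) (s : ℝ) (x : H) :
    0 ≤ (⟪x, (R ^ s) x⟫_ℂ).re :=
  ((ContinuousLinearMap.nonneg_iff_isPositive (R ^ s)).1 CFC.rpow_nonneg).re_inner_nonneg_right x

theorem re_inner_rpow_shiftInv_le (hR : 0 ≤ R) (hR1 : ‖R‖ ≤ 1) (c : ℝ≥0) {s t : ℝ} (hs : 0 < s)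
    (ht : 0 < t) (x : H) : (⟪x, (shiftInv R c ^ (s + t)) x⟫_ℂ).re ≤
      ((1 + c) ^ (-t) : ℝ≥0) * (⟪x, (R ^ s) x⟫_ℂ).re := by
  refine (re_inner_le_of_le (rpow_shiftInv_le hR hR1 c hs ht) x).trans_eq ?_
  change (⟪x, (((1 + c) ^ (-t) : ℝ≥0) : ℂ) • (R ^ s) x⟫_ℂ).re = _
  rw [inner_smul_right]
  exact Complex.re_ofReal_mul _ _

theorem summable_re_inner_rpow_shiftInv (hR : 0 ≤ R) (hR1 : ‖R‖ ≤ 1) {s t : ℝ} (hs : 0 < s)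
    (ht : 0 < t) {ι : Type*} {e : ι → H} (he : Summable fun i => (⟪e i, (R ^ s) (e i)⟫_ℂ).re)
    {c : Γ → ℝ≥0} (hc : Summable fun g => (((1 + c g) ^ (-t) : ℝ≥0) : ℝ)) :
    Summable fun j : Γ × ι => (⟪e j.2, (shiftInv R (c j.1) ^ (s + t)) (e j.2)⟫_ℂ).re :=
  Summable.of_nonneg_of_le (fun _ => re_inner_rpow_nonneg _ _ _)
    (fun _ => re_inner_rpow_shiftInv_le hR hR1 _ hs ht _)
    (hc.mul_of_nonneg he (fun _ => NNReal.coe_nonneg _) fun _ => re_inner_rpow_nonneg _ _ _)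

theorem inner_rpow_of_comp_eq {K : Type*} [NormedAddCommGroup K] [InnerProductSpace ℂ K]
    [CompleteSpace K] {a : K →L[ℂ] K} {b : H →L[ℂ] H} (ha : 0 ≤ a) (hb : 0 ≤ b)
    {J : H →L[ℂ] K} (hJ : ∀ x y, ⟪J x, J y⟫_ℂ = ⟪x, y⟫_ℂ) (h : a ∘L J = J ∘L b) {s : ℝ}
    (hs : 0 ≤ s) (x : H) : ⟪J x, (a ^ s) (J x)⟫_ℂ = ⟪x, (b ^ s) x⟫_ℂ := by
  have h1 : (a ^ s) (J x) = J ((b ^ s) x) := congr($(rpow_comp_of_comp_eq ha hb h hs) x)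
  rw [h1, hJ]

/-- The trace is tested on the vectors `e_i ⊗ δ_g` in each of the two summands. The inclusion of the
block at `g` is isometric and intertwines the block with the whole resolvent, so the diagonal
entries of the power are those of the blocks. -/
theorem crossedDirac_isPSummable (hD : D.IsFormalAdjoint D) {p q : ℝ} (hp : 0 < p) (hq : 0 < q)
    (h : IsPSummable D p) (hl : IsPSummable (mulOp ℂ l) q) :
    IsPSummable (crossedDirac D l) (p + q) := by
  obtain ⟨R, hR, htr⟩ := h
  have hR0 := hR.nonneg hD
  have hle := hR.norm_shiftInv_le hD
  have hbig := crossedDirac_isInvOneAddSq (l := l) hD hR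
  have hbig0 := hbig.nonneg (crossedDirac_isFormalAdjoint hD)
  refine ⟨_, hbig, ?_⟩
  obtain ⟨ι, e, -⟩ := exists_hilbertBasis ℂ H
  have he : Summable fun i => (⟪e i, (R ^ (p / 2)) (e i)⟫_ℂ).re := by
    have h1 := htr ι e
    rwa [CFC.abs_of_nonneg _ CFC.rpow_nonneg] at h1
  have hsum := summable_re_inner_rpow_shiftInv hR0 (hR.norm_le_one hD) (half_pos hp) (half_pos hq)
    he (summable_of_isPSummable_mulOp hq hl)
  rw [← add_div] at hsum
  have hpq : 0 ≤ (p + q) / 2 := by positivity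
  have hv : IsParseval (fun j : Γ × ι => single j.1 (e j.2)) := e.isParseval.single
  refine isTraceClass_of_isParseval CFC.rpow_nonneg (hv.sumElim hv) (Summable.sum _ ?_ ?_)
  · refine hsum.congr fun j => congrArg Complex.re (inner_rpow_of_comp_eq hbig0
      (shiftInv_nonneg R _)
      (J := inlL _ _ ∘L single j.1) (fun x y => ?_) ?_ hpq _).symm
    · exact (inner_inlL_left _ _).trans ((inner_single_left _ _ _).trans
        (congrArg _ (single_apply_self _ _)))
    · rw [← ContinuousLinearMap.comp_assoc, diagOp_comp_inlL, ContinuousLinearMap.comp_assoc,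
        sumShiftInv, boundedSum_comp_single, ContinuousLinearMap.comp_assoc]
  · refine hsum.congr fun j => congrArg Complex.re (inner_rpow_of_comp_eq hbig0
      (shiftInv_nonneg R _)
      (J := inrL _ _ ∘L single j.1) (fun x y => ?_) ?_ hpq _).symm
    · exact (inner_inrL_left _ _).trans ((inner_single_left _ _ _).trans
        (congrArg _ (single_apply_self _ _)))
    · rw [← ContinuousLinearMap.comp_assoc, diagOp_comp_inrL, ContinuousLinearMap.comp_assoc,
        sumShiftInv, boundedSum_comp_single, ContinuousLinearMap.comp_assoc]

end PSummable

/-! ### Commutators -/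

section Commutator

variable {H : Type*} [NormedAddCommGroup H] [InnerProductSpace ℂ H]
  {D D' : H →ₗ.[ℂ] H} {S S' T T' : H →L[ℂ] H}

theorem isCommutator_iff : IsCommutator D S T ↔
    ∀ x : D.domain, ∃ h : S x ∈ D.domain, D ⟨S x, h⟩ = S (D x) + T x := by
  simp only [IsCommutator, sub_eq_iff_eq_add']

theorem isCommutator_smul_one (c : ℂ) : IsCommutator D (c • 1) 0 :=
  isCommutator_iff.2 fun x => ⟨D.domain.smul_mem c x.2, by
    rw [show (⟨(c • (1 : H →L[ℂ] H)) x, _⟩ : D.domain) = c • x from rfl, D.map_smul]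
    simp⟩

theorem isCommutator_zero_left : IsCommutator D 0 0 := by
  simpa using isCommutator_smul_one (D := D) 0

theorem IsCommutator.add (h : IsCommutator D S T) (h' : IsCommutator D S' T') :
    IsCommutator D (S + S') (T + T') := by
  rw [isCommutator_iff] at *
  intro x
  obtain ⟨h₁, e₁⟩ := h x
  obtain ⟨h₂, e₂⟩ := h' x
  refine ⟨D.domain.add_mem h₁ h₂, (D.map_add ⟨_, h₁⟩ ⟨_, h₂⟩).trans ?_⟩
  rw [e₁, e₂]
  simp only [add_apply]
  abel

theorem IsCommutator.mul (h : IsCommutator D S T) (h' : IsCommutator D S' T') :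
    IsCommutator D (S * S') (T * S' + S * T') := by
  rw [isCommutator_iff] at *
  intro x
  obtain ⟨h₂, e₂⟩ := h' x
  obtain ⟨h₁, e₁⟩ := h ⟨_, h₂⟩
  refine ⟨h₁, e₁.trans ?_⟩
  rw [e₂, map_add]
  change _ = S (S' (D x)) + (T (S' x) + S (T' x))
  abel

theorem exists_isCommutator_sum {ι : Type*} (s : Finset ι) {S : ι → (H →L[ℂ] H)}
    (h : ∀ i ∈ s, ∃ T, IsCommutator D (S i) T) : ∃ T, IsCommutator D (∑ i ∈ s, S i) T :=
  Finset.sum_induction S (fun S => ∃ T, IsCommutator D S T)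
    (fun _ _ ⟨_, h⟩ ⟨_, h'⟩ => ⟨_, h.add h'⟩) ⟨0, isCommutator_zero_left⟩ h

theorem IsCommutator.add_smul (h : IsCommutator D S T) (h' : IsCommutator D' S T') (ε : ℂ) :
    IsCommutator (D + ε • D') S (T + ε • T') := by
  rw [isCommutator_iff] at *
  intro x
  obtain ⟨h₁, e₁⟩ := h ⟨x, x.2.1⟩
  obtain ⟨h₂, e₂⟩ := h' ⟨x, x.2.2⟩
  refine ⟨⟨h₁, h₂⟩, ?_⟩
  change D ⟨_, h₁⟩ + ε • D' ⟨_, h₂⟩ = S (D ⟨x, x.2.1⟩ + ε • D' ⟨x, x.2.2⟩) + (T x + ε • T' x)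
  rw [e₁, e₂, map_add, map_smul, smul_add]
  abel

section OffDiag

variable {H₀ : Type*} [NormedAddCommGroup H₀] [InnerProductSpace ℂ H₀]
  {P Q : H₀ →ₗ.[ℂ] H₀} {X C C' : H₀ →L[ℂ] H₀}

theorem isCommutator_offDiag (h : IsCommutator P X C) (h' : IsCommutator Q X C') :
    IsCommutator (offDiag P Q) (diagOp X X)
      (inlL H₀ H₀ ∘L C ∘L WithLp.sndL 2 ℂ H₀ H₀ + inrL H₀ H₀ ∘L C' ∘L WithLp.fstL 2 ℂ H₀ H₀) := by
  intro x
  obtain ⟨h₁, e₁⟩ := h ⟨_, x.2.2⟩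
  obtain ⟨h₂, e₂⟩ := h' ⟨_, x.2.1⟩
  exact ⟨⟨h₂, h₁⟩, WithLp.ofLp_injective 2
    (Prod.ext (e₁.trans (add_zero _).symm) (e₂.trans (zero_add _).symm))⟩

theorem IsCommutator.of_offDiag (h : IsCommutator (offDiag P Q) (diagOp X X) 0) :
    IsCommutator P X 0 ∧ IsCommutator Q X 0 := by
  constructor
  · intro x
    obtain ⟨h₁, e₁⟩ := h ⟨WithLp.toLp 2 (0, (x : H₀)), zero_mem _, x.2⟩
    exact ⟨h₁.2, congrArg (fun z => z.fst) e₁⟩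
  · intro x
    obtain ⟨h₁, e₁⟩ := h ⟨WithLp.toLp 2 ((x : H₀), 0), x.2, zero_mem _⟩
    exact ⟨h₁.1, congrArg (fun z => z.snd) e₁⟩

end OffDiag

variable {Γ : Type*}

/-- A coordinatewise identity suffices: square summability of `T_g (X x)_g` is automatic, as these
are the coordinates of the vector `X (T x) + C x`. -/
theorem isCommutator_sumOp {T : Γ → (H →ₗ.[ℂ] H)} {X C : EllTwo Γ H →L[ℂ] EllTwo Γ H}
    (h : ∀ (x : (sumOp T).domain) (g : Γ), ∃ hg : X x g ∈ (T g).domain,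
      T g ⟨X x g, hg⟩ = X (sumOp T x) g + C x g) : IsCommutator (sumOp T) X C := by
  rw [isCommutator_iff]
  intro x
  choose hg he using h x
  refine ⟨⟨hg, ?_⟩, lp.ext (funext he)⟩
  convert lp.memℓp (X (sumOp T x) + C x) using 1
  exact funext he

section Crossed

variable [CompleteSpace H] {A : Type*} [CStarAlgebra A] [Group Γ] {π : A →⋆ₐ[ℂ] (H →L[ℂ] H)}
  {α : Γ →* (A ≃⋆ₐ[ℂ] A)} {l : Γ → ℤ}

theorem isCommutator_tensorOne_coeffRep {a : A} {C : ℝ} {T : Γ → (H →L[ℂ] H)}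
    (hT : ∀ g, IsCommutator D (π (α g⁻¹ a)) (T g)) (hC : ∀ g, ‖T g‖ ≤ C) :
    IsCommutator (tensorOne D) (coeffRep π α a) (boundedSum T C hC) :=
  isCommutator_sumOp fun x g => isCommutator_iff.1 (hT g) ⟨(x : EllTwo Γ H) g, x.2.1 g⟩

omit [CompleteSpace H] in
theorem isCommutator_tensorOne_translation (h : Γ) :
    IsCommutator (tensorOne D) (translation H h) 0 :=
  isCommutator_sumOp fun x g => ⟨x.2.1 (h⁻¹ * g), (add_zero _).symm⟩

theorem isCommutator_mulOp_coeffRep (a : A) : IsCommutator (mulOp H l) (coeffRep π α a) 0 :=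
  isCommutator_sumOp fun x g => ⟨trivial, by
    change (l g : ℂ) • π (α g⁻¹ a) _ = π (α g⁻¹ a) ((l g : ℂ) • _) + 0
    rw [map_smul, add_zero]
    rfl⟩

omit [CompleteSpace H] in
theorem isCommutator_mulOp_translation {h : Γ} {C : ℝ}
    (hC : ∀ g, ‖((l g : ℂ) - l (h⁻¹ * g)) • (1 : H →L[ℂ] H)‖ ≤ C) :
    IsCommutator (mulOp H l) (translation H h) (boundedSum _ C hC * translation H h) :=
  isCommutator_sumOp fun x g => ⟨trivial, by
    change (l g : ℂ) • (x : EllTwo Γ H) (h⁻¹ * g) = (l (h⁻¹ * g) : ℂ) • (x : EllTwo Γ H) (h⁻¹ * g) +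
      ((l g : ℂ) - l (h⁻¹ * g)) • (x : EllTwo Γ H) (h⁻¹ * g)
    rw [sub_smul]
    abel⟩

theorem exists_isCommutator_diracPart {𝒜 : NonUnitalStarSubalgebra ℂ A}
    (hl : IsProperTranslationBounded l)
    (hbdd : ∀ a ∈ 𝒜, ∃ C : ℝ, ∀ g, ∃ T : H →L[ℂ] H, IsCommutator D (π (α g a)) T ∧ ‖T‖ ≤ C)
    (ε : ℂ) {X : EllTwo Γ H →L[ℂ] EllTwo Γ H} (hX : IsFiniteSum 𝒜 π α X) :
    ∃ T, IsCommutator (diracPart D l ε) X T := by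
  obtain ⟨s, x, hx, rfl⟩ := hX
  refine exists_isCommutator_sum s fun h _ => ?_
  obtain ⟨C, hC⟩ := hbdd _ (hx h)
  -- The coordinate of `π̃(a)` at `g` involves `α_{g⁻¹}`; the bound `C` holds over the whole orbit.
  choose T hT hTC using fun g : Γ => hC g⁻¹
  obtain ⟨C', hC'⟩ := hl.bounded h
  have hle : ∀ g, ‖((l g : ℂ) - l (h⁻¹ * g)) • (1 : H →L[ℂ] H)‖ ≤ C' := fun g => by
    rw [norm_smul, ← Int.cast_sub, Complex.norm_intCast, ← Int.cast_abs]
    have h1 : ((|l g - l (h⁻¹ * g)| : ℤ) : ℝ) ≤ C' := by exact_mod_cast hC' g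
    refine (mul_le_of_le_one_right (by positivity) ContinuousLinearMap.norm_id_le).trans h1
  exact ⟨_, ((isCommutator_tensorOne_coeffRep hT hTC).add_smul
    (isCommutator_mulOp_coeffRep _) ε).mul
    ((isCommutator_tensorOne_translation h).add_smul (isCommutator_mulOp_translation hle) ε)⟩

theorem exists_isCommutator_crossedDirac {𝒜 : NonUnitalStarSubalgebra ℂ A}
    (hl : IsProperTranslationBounded l)
    (hbdd : ∀ a ∈ 𝒜, ∃ C : ℝ, ∀ g, ∃ T : H →L[ℂ] H, IsCommutator D (π (α g a)) T ∧ ‖T‖ ≤ C)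
    {X : EllTwo Γ H →L[ℂ] EllTwo Γ H} (hX : IsFiniteSum 𝒜 π α X) :
    ∃ T, IsCommutator (crossedDirac D l) (diagOp X X) T := by
  obtain ⟨T, hT⟩ := exists_isCommutator_diracPart hl hbdd (-Complex.I) hX
  obtain ⟨T', hT'⟩ := exists_isCommutator_diracPart hl hbdd Complex.I hX
  rw [crossedDirac_eq]
  exact ⟨_, isCommutator_offDiag hT hT'⟩

end Crossed

end Commutator

/-! ### Density and separability -/

section Density

variable {A : Type*} [CStarAlgebra A] {H : Type*} [NormedAddCommGroup H] [InnerProductSpace ℂ H]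
  [CompleteSpace H] {Γ : Type*} [Group Γ] {𝒜 : NonUnitalStarSubalgebra ℂ A}
  {π : A →⋆ₐ[ℂ] (H →L[ℂ] H)} {α : Γ →* (A ≃⋆ₐ[ℂ] A)}

theorem continuous_coeffRep : Continuous (coeffRep π α : A → EllTwo Γ H →L[ℂ] EllTwo Γ H) :=
  AddMonoidHomClass.continuous_of_bound (coeffRep π α) 1 fun a => by
    rw [one_mul]
    exact (norm_boundedSum_le _ _ fun g => (NonUnitalStarAlgHom.norm_apply_le π _).trans
      (StarAlgEquiv.norm_map (α g⁻¹) a).le).trans_eq (abs_norm a)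

/-- By covariance the finite sums with arbitrary coefficients already form a star algebra, and it
contains the generators. -/
theorem isFiniteSum_of_mem_adjoin {X : EllTwo Γ H →L[ℂ] EllTwo Γ H}
    (hX : X ∈ StarAlgebra.adjoin ℂ
      (Set.range (coeffRep π α) ∪ Set.range (translation H : Γ → _))) :
    IsFiniteSum (⊤ : NonUnitalStarSubalgebra ℂ A) π α X := by
  have hα : ∀ g, ∀ a ∈ (⊤ : NonUnitalStarSubalgebra ℂ A), α g a ∈
    (⊤ : NonUnitalStarSubalgebra ℂ A) := fun _ _ _ => trivial
  have hcoeff : ∀ a, IsFiniteSum (⊤ : NonUnitalStarSubalgebra ℂ A) π α (coeffRep π α a) :=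
    fun a => by
      have := IsFiniteSum.single (π := π) (α := α)
        (show a ∈ (⊤ : NonUnitalStarSubalgebra ℂ A) from trivial) 1
      rwa [translation_one, mul_one] at this
  induction hX using StarAlgebra.adjoin_induction with
  | mem X hX =>
    rcases hX with ⟨a, rfl⟩ | ⟨g, rfl⟩
    · exact hcoeff a
    · have := IsFiniteSum.single (π := π) (α := α)
        (show (1 : A) ∈ (⊤ : NonUnitalStarSubalgebra ℂ A) from trivial) g
      rwa [map_one, one_mul] at this
  | algebraMap c =>
    rw [← AlgHomClass.commutes (coeffRep π α) c]
    exact hcoeff _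
  | add X Y _ _ hX hY => exact hX.add hY
  | mul X Y _ _ hX hY => exact hX.mul hα hY
  | star X _ hX => exact hX.star hα

theorem IsFiniteSum.mem_reducedCrossedProduct {X : EllTwo Γ H →L[ℂ] EllTwo Γ H}
    (hX : IsFiniteSum 𝒜 π α X) : X ∈ reducedCrossedProduct π α := by
  obtain ⟨s, x, -, rfl⟩ := hX
  refine StarSubalgebra.le_topologicalClosure _ (sum_mem fun g _ => mul_mem ?_ ?_)
  · exact StarAlgebra.subset_adjoin ℂ _ (Or.inl ⟨_, rfl⟩)
  · exact StarAlgebra.subset_adjoin ℂ _ (Or.inr ⟨_, rfl⟩)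

/-- For a fixed finite index set the sum depends continuously on the coefficient family, and
`𝒜`-valued families are dense in the product. -/
theorem mem_closure_isFiniteSum (h𝒜 : Dense (𝒜 : Set A)) {X : EllTwo Γ H →L[ℂ] EllTwo Γ H}
    (hX : IsFiniteSum (⊤ : NonUnitalStarSubalgebra ℂ A) π α X) :
    X ∈ closure {Y | IsFiniteSum 𝒜 π α Y} := by
  obtain ⟨s, x, -, rfl⟩ := hX
  have hc : Continuous fun x : Γ → A => ∑ g ∈ s, coeffRep π α (x g) * translation H g :=
    continuous_finsetSum _ fun g _ =>
      (continuous_coeffRep.comp (continuous_apply g)).mul continuous_const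
  exact map_mem_closure (f := fun x : Γ → A => ∑ g ∈ s, coeffRep π α (x g) * translation H g) hc
    (dense_pi Set.univ (fun _ _ => h𝒜) x) fun y hy => ⟨s, y, fun g => hy g trivial, rfl⟩

theorem dense_finiteSums (h𝒜 : Dense (𝒜 : Set A)) (hα : ∀ g, ∀ a ∈ 𝒜, α g a ∈ 𝒜) :
    Dense (finiteSums 𝒜 π α hα : Set (reducedCrossedProduct π α)) := by
  refine Subtype.dense_iff.2 fun X hX => ?_
  have h1 : closure {Y | IsFiniteSum 𝒜 π α Y} ⊆
      closure ((↑) '' (finiteSums 𝒜 π α hα : Set (reducedCrossedProduct π α))) :=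
    closure_mono fun Y hY => ⟨⟨Y, hY.mem_reducedCrossedProduct⟩, hY, rfl⟩
  refine h1 (closure_minimal (fun Y hY => ?_) isClosed_closure hX)
  exact mem_closure_isFiniteSum h𝒜 (isFiniteSum_of_mem_adjoin hY)

theorem separableSpace_reducedCrossedProduct [TopologicalSpace.SeparableSpace A] [Countable Γ] :
    TopologicalSpace.SeparableSpace (reducedCrossedProduct π α) := by
  have h : TopologicalSpace.IsSeparable
      (reducedCrossedProduct π α : Set (EllTwo Γ H →L[ℂ] EllTwo Γ H)) := by
    have h1 : TopologicalSpace.IsSeparable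
        (⋃ g : Γ, Set.range fun a : A => coeffRep π α a * translation H g) :=
      .iUnion fun g => TopologicalSpace.isSeparable_range
        (continuous_coeffRep.mul continuous_const)
    refine ((h1.span (R := ℂ)).closure).mono (closure_mono fun X hX => ?_)
    obtain ⟨s, x, -, rfl⟩ := isFiniteSum_of_mem_adjoin hX
    exact sum_mem fun g _ => Submodule.subset_span (Set.mem_iUnion.2 ⟨g, _, rfl⟩)
  exact h.separableSpace

theorem IsProperTranslationBounded.countable {l : Γ → ℤ} (hl : IsProperTranslationBounded l) :
    Countable Γ := by
  rw [← Set.countable_univ_iff]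
  have : (Set.univ : Set Γ) = ⋃ n : ℤ, {g | l g = n} := by ext; simp
  rw [this]
  exact Set.countable_iUnion fun n => (hl.finite_level n).countable

end Density

/-! ### Non-degeneracy -/

section Nondegenerate

variable {A : Type*} [CStarAlgebra A] {H : Type*} [NormedAddCommGroup H] [InnerProductSpace ℂ H]
  [CompleteSpace H] {Γ : Type*} [Group Γ] {𝒜 : NonUnitalStarSubalgebra ℂ A}
  {π : A →⋆ₐ[ℂ] (H →L[ℂ] H)} {α : Γ →* (A ≃⋆ₐ[ℂ] A)} {D : H →ₗ.[ℂ] H} {l : Γ → ℤ}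

/-- Coefficients outside `s` are arbitrary in `IsFiniteSum`; setting them to zero makes the
coefficient formula at `δ_1` valid for every `g`. -/
theorem IsFiniteSum.exists_support {X : EllTwo Γ H →L[ℂ] EllTwo Γ H}
    (hX : IsFiniteSum 𝒜 π α X) : ∃ (s : Finset Γ) (x : Γ → A), (∀ g, x g ∈ 𝒜) ∧
      (∀ g ∉ s, x g = 0) ∧ X = ∑ g ∈ s, coeffRep π α (x g) * translation H g := by
  classical
  obtain ⟨s, x, hx, rfl⟩ := hX
  refine ⟨s, fun g => if g ∈ s then x g else 0, fun g => ?_, fun g hg => if_neg hg,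
    Finset.sum_congr rfl fun g hg => by simp only [if_pos hg]⟩
  dsimp only
  split_ifs
  exacts [hx g, zero_mem _]

theorem sum_apply_single_one {s : Finset Γ} {x : Γ → A} (hs : ∀ g ∉ s, x g = 0) (ξ : H) (g : Γ) :
    (∑ k ∈ s, coeffRep π α (x k) * translation H k : EllTwo Γ H →L[ℂ] EllTwo Γ H)
      (single 1 ξ) g = π (α g⁻¹ (x g)) ξ := by
  rw [sum_apply, lp.coeFn_sum, Finset.sum_apply]
  have h1 : ∀ k, (coeffRep π α (x k) * translation H k : EllTwo Γ H →L[ℂ] EllTwo Γ H)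
      (single 1 ξ) g = π (α g⁻¹ (x k)) (single 1 ξ (k⁻¹ * g)) := fun k => rfl
  simp only [h1]
  rw [Finset.sum_eq_single g]
  · rw [inv_mul_cancel, single_apply_self]
  · intro k _ hk
    rw [single_apply_of_ne, map_zero]
    rwa [Ne, inv_mul_eq_one]
  · intro hg
    rw [hs g hg]
    simp

omit [CompleteSpace H] in
theorem diracPart_single_one (hl1 : l 1 = 0) (ε : ℂ) (ξ : D.domain) :
    ∃ h : single (1 : Γ) (ξ : H) ∈ (diracPart D l ε).domain,
      diracPart D l ε ⟨_, h⟩ = single 1 (D ξ) := by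
  have h0 : ∀ k : Γ, ∃ hk : single (1 : Γ) (ξ : H) k ∈ D.domain,
      D ⟨_, hk⟩ = single (1 : Γ) (D ξ) k ∧ (l k : ℂ) • single (1 : Γ) (ξ : H) k = 0 := fun k => by
    by_cases hk : k = 1
    · subst hk
      simp only [single_apply_self, hl1]
      exact ⟨ξ.2, trivial, by simp⟩
    · simp only [single_apply_of_ne hk]
      exact ⟨zero_mem _, D.map_zero, smul_zero _⟩
  choose h1 h2 h3 using h0
  have hmem : single (1 : Γ) (ξ : H) ∈ (diracPart D l ε).domain := by
    refine ⟨⟨h1, ?_⟩, fun _ => trivial, ?_⟩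
    · convert lp.memℓp (single (1 : Γ) (D ξ)) using 1
      exact funext h2
    · convert (zero_memℓp : Memℓp (0 : Γ → H) 2) using 1
      exact funext h3
  refine ⟨hmem, lp.ext (funext fun k => ?_)⟩
  rw [diracPart_apply]
  refine (congrArg₂ (· + ·) (h2 k) (congrArg (ε • ·) (h3 k))).trans ?_
  simp

theorem eq_smul_one_of_isCommutator_zero (hπ : Function.Injective π)
    (hD : Dense (D.domain : Set H)) (hl : ∀ g, l g = 0 ↔ g = 1)
    (hscalar : ∀ a ∈ 𝒜, IsCommutator D (π a) 0 → ∃ c : ℂ, a = c • (1 : A))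
    {X : EllTwo Γ H →L[ℂ] EllTwo Γ H} (hX : IsFiniteSum 𝒜 π α X)
    (h : IsCommutator (crossedDirac D l) (diagOp X X) 0) : ∃ c : ℂ, X = c • 1 := by
  obtain ⟨s, x, hx, hs, rfl⟩ := hX.exists_support
  rw [crossedDirac_eq] at h
  obtain ⟨hm, hp⟩ := h.of_offDiag
  have hl1 : l 1 = 0 := (hl 1).2 rfl
  -- This is the commutator relation on `ξ ⊗ δ_1` at coordinate `g`. As `l 1 = 0`, the `M_l` term
  -- contributes only after applying the finite sum.
  have key : ∀ ε : ℂ, IsCommutator (diracPart D l ε)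
      (∑ g ∈ s, coeffRep π α (x g) * translation H g) 0 → ∀ (ξ : D.domain) (g : Γ),
      ∃ hg : π (α g⁻¹ (x g)) ξ ∈ D.domain,
        D ⟨_, hg⟩ + ε • (l g : ℂ) • π (α g⁻¹ (x g)) ξ = π (α g⁻¹ (x g)) (D ξ) := by
    intro ε hε ξ g
    obtain ⟨h1, e1⟩ := diracPart_single_one (Γ := Γ) hl1 ε ξ
    obtain ⟨h2, e2⟩ := isCommutator_iff.1 hε ⟨_, h1⟩
    rw [e1] at e2
    have e3 := congrArg (fun z : EllTwo Γ H => z g) e2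
    have h3 := h2.1.1 g
    have e4 := sum_apply_single_one (π := π) (α := α) hs (ξ : H) g
    have e5 := sum_apply_single_one (π := π) (α := α) hs (D ξ) g
    refine ⟨e4 ▸ h3, Eq.trans (congrArg₂ (· + ·) (congrArg D (Subtype.ext e4.symm))
      (congrArg (fun z : H => ε • (l g : ℂ) • z) e4.symm)) (e3.trans ?_)⟩
    exact (add_zero _).trans e5
  have hzero : ∀ g ≠ 1, x g = 0 := fun g hg => by
    have h1 : π (α g⁻¹ (x g)) = 0 := by
      refine ContinuousLinearMap.ext_on (hD.mono Submodule.subset_span) fun ξ hξ => ?_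
      obtain ⟨h1, e1⟩ := key _ hm ⟨ξ, hξ⟩ g
      obtain ⟨_, e2⟩ := key _ hp ⟨ξ, hξ⟩ g
      -- The equations for `ε = -i` and `ε = i` have the same `D` term and the same right side, so
      -- `2 i l(g) π(α_{g⁻¹}(x_g)) ξ = 0`.
      have e3 := e1.trans e2.symm
      rw [add_right_inj, neg_smul, eq_comm, ← sub_eq_zero, sub_neg_eq_add, ← two_smul ℂ,
        smul_smul, smul_smul, smul_eq_zero] at e3
      refine e3.resolve_left ?_
      have : (l g : ℂ) ≠ 0 := by exact_mod_cast fun h => hg ((hl g).1 h)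
      simp [this]
    rw [← map_zero π] at h1
    simpa using hπ h1
  have hone : IsCommutator D (π (x 1)) 0 := isCommutator_iff.2 fun ξ => by
    have := key _ hp ξ 1
    simpa [hl1] using this
  obtain ⟨c, hc⟩ := hscalar _ (hx 1) hone
  refine ⟨c, ?_⟩
  rw [Finset.sum_eq_single 1 (fun g _ hg => by rw [hzero g hg]; simp)
    (fun h1 => by rw [hs 1 h1]; simp), translation_one, mul_one, hc, map_smul, map_one]

end Nondegenerate

end CrossedTriple

end

/-! ### The main theorem -/

open CrossedTriple in
theorem mainTheorem1 {A : Type*} [CStarAlgebra A]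
    {H : Type*} [NormedAddCommGroup H] [InnerProductSpace ℂ H] [CompleteSpace H]
    {Γ : Type*} [Group Γ]
    (𝒜 : NonUnitalStarSubalgebra ℂ A) (π : A →⋆ₐ[ℂ] (H →L[ℂ] H)) (hπ : Function.Injective π)
    (D : H →ₗ.[ℂ] H) (hD : IsOddSpectralTriple 𝒜 π D)
    (α : Γ →* (A ≃⋆ₐ[ℂ] A)) (l : Γ → ℤ) (hl : IsProperTranslationBounded l)
    (hα : ∀ g, ∀ a ∈ 𝒜, α g a ∈ 𝒜)
    (hbdd : ∀ a ∈ 𝒜, ∃ C : ℝ, ∀ g, ∃ T : H →L[ℂ] H, IsCommutator D (π (α g a)) T ∧ ‖T‖ ≤ C) :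
    IsEvenSpectralTriple (finiteSums 𝒜 π α hα) (crossedRep π α) (crossedDirac D l) ∧
    (∀ p q : ℝ, 0 < p → 0 < q → IsPSummable D p → IsPSummable (mulOp ℂ l) q →
      IsPSummable (crossedDirac D l) (p + q)) ∧
    (IsNondegenerate 𝒜 π D →
      IsNondegenerate (finiteSums 𝒜 π α hα) (crossedRep π α) (crossedDirac D l)) := by
  have hsymm : D.IsFormalAdjoint D := by
    have h := LinearPMap.adjoint_isFormalAdjoint hD.dense_domain
    rwa [LinearPMap.isSelfAdjoint_def.1 hD.selfAdjoint] at h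
  obtain ⟨R, hR, -⟩ := hD.compact
  have hsa := crossedDirac_isSelfAdjoint (l := l) hsymm hR
  have := hl.countable
  have := hD.separable
  refine ⟨{
    separable := separableSpace_reducedCrossedProduct
    dense := dense_finiteSums hD.dense hα
    dense_domain := hsa.dense_domain
    selfAdjoint := hsa
    compact := crossedDirac_hasCompactResolvent hsymm hD.compact hl.finite_level
    commutator := fun a ha => exists_isCommutator_crossedDirac hl hbdd ha
    graded_rep := ⟨_, _, rfl⟩
    graded_dirac := ?_ }, fun p q hp hq => crossedDirac_isPSummable hsymm hp hq, fun hnd => ?_⟩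
  · rw [crossedDirac_eq] at hsa ⊢
    obtain ⟨h1, h2⟩ := dense_and_eq_adjoint_of_isSelfAdjoint_offDiag hsa
    exact ⟨_, h1, by rw [← h2]⟩
  · refine ⟨fun X Y hXY => Subtype.ext (ContinuousLinearMap.ext fun x => ?_),
      fun X hX => ⟨fun h => ?_, ?_⟩⟩
    -- The crossed product already consists of operators, so faithfulness is seen on the first
    -- summand.
    · exact congrArg (fun z => z.fst) congr($hXY (inlL _ _ x))
    · obtain ⟨c, hc⟩ := eq_smul_one_of_isCommutator_zero hπ hD.dense_domain hl.eq_zero_iff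
        (fun a ha => (hnd.scalar a ha).1) hX h
      exact ⟨c, Subtype.ext hc⟩
    · rintro ⟨c, rfl⟩
      rw [map_smul, map_one]
      exact isCommutator_smul_one c
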